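/- \textbf{Terms.} Let $S$ be a set of name sorts. Types are generated by $T ::= \diamond \mid T\to\diamond \mid s\to\diamond$ ($s\in S$): non-abstractions, process-abstractions and name-abstractions. Fix a map $\mathrm{ob}$ from $S$ \emph{onto} the set of types; names of sort $s$ carry terms of type $\mathrm{ob}(s)$. Each sort has infinitely many name constants and name variables ($x,y$); $m,n,d$ range over all names; process variables $X,Y$ are typed. The terms of HOmp are the well-typed expressions, up to $\alpha$-conversion, of $$P,Q ::= 0 \mid X \mid m(X).P \mid \overline m(Q) \mid P\,|\,Q \mid \langle X\rangle P \mid P\langle Q\rangle \mid \langle x\rangle P \mid P\langle n\rangle ,$$ where $0$, $m(X).P$, $\overline m(Q)$, $P|Q$ and both applications have type $\diamond$; the components of $P|Q$ and the bodies of input prefixes and of abstractions have type $\diamond$; for $m$ of sort $s$, $X$ in $m(X).P$ and $Q$ in $\overline m(Q)$ have type $\mathrm{ob}(s)$; $\langle X\rangle P$ has type $T\to\diamond$ for $X$ of type $T$, $\langle x\rangle P$ has type $s\to\diamond$ for $x$ of sort $s$, and applications respect these types. A term is closed if it has no free process variable. Substitutions respect types and sorts. \textbf{Semantics.} $\equiv$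 is the least congruence on terms such that $|$ is associative and commutative with unit $0$, $(\langle X\rangle P)\langle Q\rangle\equiv P\{Q/X\}$ and $(\langle x\rangle P)\langle n\rangle\equiv P\{n/x\}$. Transitions $P\xrightarrow{\lambda}P'$ with $\lambda = m(X),\overline m(A),\tau$ are the least relations such that $m(X).P\xrightarrow{m(X)}P$; $\overline m(Q)\xrightarrow{\overline m(Q)}0$; if $P\xrightarrow{\lambda}P'$ then $P|Q\xrightarrow{\lambda}P'|Q$ (the variable bound by $\lambda$ not free in $Q$) and symmetrically; if $P\xrightarrow{\overline m(A)}P'$ and $Q\xrightarrow{m(X)}Q'$ then $P|Q\xrightarrow{\tau}P'|Q'\{A/X\}$ and symmetrically; if $Q\equiv P\xrightarrow{\lambda}P'\equiv Q'$ then $Q\xrightarrow{\lambda}Q'$. \textbf{Bisimilarities.} All relations are between terms of equal type. A symmetric relation $\mathcal R$ on closed terms is a strong HO bisimulation if $P\,\mathcal R\,Q$ implies: if $P=\langle Y\rangle P'$ then $Q=\langle Y\rangle Q'$ with $P'\{A/Y\}\,\mathcal R\,Q'\{A/Y\}$ for every closed $A$; if $P=\langle y\rangle A$ then $Q=\langle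 y\rangle B$ with $A\,\mathcal R\,B$; if $P\xrightarrow{\overline m(A)}P'$ then $Q\xrightarrow{\overline m(B)}Q'$ with $A\,\mathcal R\,B$, $P'\,\mathcal R\,Q'$; if $P\xrightarrow{m(X)}P'$ then $Q\xrightarrow{m(X)}Q'$ with $P'\{A/X\}\,\mathcal R\,Q'\{A/X\}$ for every closed $A$; if $P\xrightarrow{\tau}P'$ then $Q\xrightarrow{\tau}Q'$ with $P'\,\mathcal R\,Q'$. Strong HO bisimilarity $\sim_{HO}$ is the largest strong HO bisimulation, extended to open terms by: $P\sim_{HO}Q$ iff $P\{\tilde R/\tilde X\}\sim_{HO}Q\{\tilde R/\tilde X\}$ for all closed $\tilde R$, where $\tilde X$ are the free process variables of $P,Q$. A symmetric relation $\mathcal R$ on (open or closed) terms is a strong HO-IO bisimulation if $P\,\mathcal R\,Q$ implies: if $P$ is a process-abstraction $\langle Y\rangle A$ then $Q$ is a process-abstraction $\langle Y\rangle B$ with $A\,\mathcal R\,B$; if $P$ is a name-abstraction $\langle y\rangle A$ then $Q$ is a name-abstraction $\langle y\rangle B$ with $A\,\mathcal R\,B$ (in these two clauses a process variable $X$ of abstraction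 type is read as $\langle Y\rangle(X\langle Y\rangle)$, respectively $\langle y\rangle(X\langle y\rangle)$); if $P\xrightarrow{\overline m(A)}P'$ then $Q\xrightarrow{\overline m(B)}Q'$ with $A\,\mathcal R\,B$, $P'\,\mathcal R\,Q'$; if $P\xrightarrow{m(X)}P'$ then $Q\xrightarrow{m(X)}Q'$ with $P'\,\mathcal R\,Q'$; if $P\equiv X\,|\,P'$ then $Q\equiv X\,|\,Q'$ with $P'\,\mathcal R\,Q'$; if $P\equiv X\langle A\rangle\,|\,P'$ then $Q\equiv X\langle B\rangle\,|\,Q'$ with $A\,\mathcal R\,B$, $P'\,\mathcal R\,Q'$; if $P\equiv X\langle d\rangle\,|\,P'$ then $Q\equiv X\langle d\rangle\,|\,Q'$ with $P'\,\mathcal R\,Q'$. Strong HO-IO bisimilarity $\sim_{HOIO}$ is the largest strong HO-IO bisimulation. \textbf{Lemma.} On all HOmp terms, open and closed, $\sim_{HO}\;=\;\sim_{HOIO}$: for all terms $P,Q$ of the same type, $P\sim_{HO}Q$ if and only if $P\sim_{HOIO}Q$. -/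

import Mathlib

namespace HOmp

universe u

/-- Types of terms over a set `S` of name sorts: non-abstractions (processes), process-abstractions
taking an argument of type `T`, and name-abstractions taking a name of sort `s`.
The body of an abstraction is a process. Being inductive, the types have finite order. -/
inductive Ty (S : Type u) : Type u
  | proc : Ty S
  | pabs : Ty S → Ty S
  | nabs : S → Ty S

/-- `Var l a`: a variable of sort or type `a` in the scope `l` (a de Bruijn index). -/
inductive Var {α : Type u} : List α → α → Type u
  | zero {a : α} {l : List α} : Var (a :: l) a
  | succ {a b : α} {l : List α} : Var l a → Var (b :: l) a

/-- Names of sort `s`: one of infinitely many name constants, or a name variable in scope. -/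
inductive Nm {S : Type u} (Δ : List S) (s : S) : Type u
  | const : ℕ → Nm Δ s
  | var : Var Δ s → Nm Δ s

/-- Well-typed terms (up to α-conversion) with free name variables in `Δ` and free process
variables in `Γ`. The function `ob` is the sorting: a name of sort `s` carries terms of type
`ob s`. A term is closed when `Γ = []`. -/
inductive Tm {S : Type u} (ob : S → Ty S) : List S → List (Ty S) → Ty S → Type u
  | nil {Δ : List S} {Γ : List (Ty S)} : Tm ob Δ Γ Ty.proc
  | var {Δ : List S} {Γ : List (Ty S)} {T : Ty S} : Var Γ T → Tm ob Δ Γ T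
  | inp {Δ : List S} {Γ : List (Ty S)} {s : S} :
      Nm Δ s → Tm ob Δ (ob s :: Γ) Ty.proc → Tm ob Δ Γ Ty.proc
  | out {Δ : List S} {Γ : List (Ty S)} {s : S} :
      Nm Δ s → Tm ob Δ Γ (ob s) → Tm ob Δ Γ Ty.proc
  | par {Δ : List S} {Γ : List (Ty S)} :
      Tm ob Δ Γ Ty.proc → Tm ob Δ Γ Ty.proc → Tm ob Δ Γ Ty.proc
  | pabs {Δ : List S} {Γ : List (Ty S)} {T : Ty S} :
      Tm ob Δ (T :: Γ) Ty.proc → Tm ob Δ Γ (Ty.pabs T)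
  | papp {Δ : List S} {Γ : List (Ty S)} {T : Ty S} :
      Tm ob Δ Γ (Ty.pabs T) → Tm ob Δ Γ T → Tm ob Δ Γ Ty.proc
  | nabs {Δ : List S} {Γ : List (Ty S)} {s : S} :
      Tm ob (s :: Δ) Γ Ty.proc → Tm ob Δ Γ (Ty.nabs s)
  | napp {Δ : List S} {Γ : List (Ty S)} {s : S} :
      Tm ob Δ Γ (Ty.nabs s) → Nm Δ s → Tm ob Δ Γ Ty.proc

/-! ### Substitution -/

/-- Simultaneous substitutions of names for name variables. -/
def NSub {S : Type u} (Δ Δ' : List S) : Type u := ∀ s : S, Var Δ s → Nm Δ' s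

def Nm.nsub {S : Type u} {Δ Δ' : List S} (ρ : NSub Δ Δ') {s : S} : Nm Δ s → Nm Δ' s
  | .const n => .const n
  | .var x => ρ s x

def NSub.wk {S : Type u} {Δ : List S} (s : S) : NSub Δ (s :: Δ) := fun _ x => .var x.succ

def NSub.lift {S : Type u} {Δ Δ' : List S} (ρ : NSub Δ Δ') (s : S) :
    NSub (s :: Δ) (s :: Δ')
  | _, .zero => .var .zero
  | _, .succ x => (ρ _ x).nsub (NSub.wk s)

/-- The substitution `{n/x}` of a name for the most recently bound name variable. -/
def NSub.single {S : Type u} {Δ : List S} {s : S} (n : Nm Δ s) : NSub (s :: Δ) Δ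
  | _, .zero => n
  | _, .succ x => .var x

/-- Renamings of process variables. -/
def Ren {S : Type u} (Γ Γ' : List (Ty S)) : Type u := ∀ T : Ty S, Var Γ T → Var Γ' T

def Ren.wk {S : Type u} {Γ : List (Ty S)} (T : Ty S) : Ren Γ (T :: Γ) := fun _ X => X.succ

def Ren.lift {S : Type u} {Γ Γ' : List (Ty S)} (r : Ren Γ Γ') (T : Ty S) :
    Ren (T :: Γ) (T :: Γ')
  | _, .zero => .zero
  | _, .succ X => (r _ X).succ

section

variable {S : Type u} {ob : S → Ty S}

/-- Application of a name substitution to a term. -/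
def Tm.nsub {Δ Δ' : List S} {Γ : List (Ty S)} {T : Ty S} (ρ : NSub Δ Δ') :
    Tm ob Δ Γ T → Tm ob Δ' Γ T
  | .nil => .nil
  | .var X => .var X
  | .inp m P => .inp (m.nsub ρ) (P.nsub ρ)
  | .out m Q => .out (m.nsub ρ) (Q.nsub ρ)
  | .par P Q => .par (P.nsub ρ) (Q.nsub ρ)
  | .pabs P => .pabs (P.nsub ρ)
  | .papp P Q => .papp (P.nsub ρ) (Q.nsub ρ)
  | .nabs P => .nabs (P.nsub (ρ.lift _))
  | .napp P n => .napp (P.nsub ρ) (n.nsub ρ)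

/-- Renaming of the process variables of a term. -/
def Tm.ren {Δ : List S} {Γ Γ' : List (Ty S)} {T : Ty S} (r : Ren Γ Γ') :
    Tm ob Δ Γ T → Tm ob Δ Γ' T
  | .nil => .nil
  | .var X => .var (r _ X)
  | .inp m P => .inp m (P.ren (r.lift _))
  | .out m Q => .out m (Q.ren r)
  | .par P Q => .par (P.ren r) (Q.ren r)
  | .pabs P => .pabs (P.ren (r.lift _))
  | .papp P Q => .papp (P.ren r) (Q.ren r)
  | .nabs P => .nabs (P.ren r)
  | .napp P n => .napp (P.ren r) n

/-- Weakening: `P` seen in a scope with one more process variable, which does not occur in it. -/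
def Tm.wk {Δ : List S} {Γ : List (Ty S)} {U : Ty S} (T : Ty S) (P : Tm ob Δ Γ U) :
    Tm ob Δ (T :: Γ) U :=
  P.ren (Ren.wk T)

/-- Simultaneous substitutions of terms for process variables. -/
def PSub (ob : S → Ty S) (Δ : List S) (Γ Γ' : List (Ty S)) : Type u :=
  ∀ T : Ty S, Var Γ T → Tm ob Δ Γ' T

def PSub.lift {Δ : List S} {Γ Γ' : List (Ty S)} (σ : PSub ob Δ Γ Γ') (T : Ty S) :
    PSub ob Δ (T :: Γ) (T :: Γ')
  | _, .zero => .var .zero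
  | _, .succ X => (σ _ X).wk T

def PSub.nlift {Δ : List S} {Γ Γ' : List (Ty S)} (σ : PSub ob Δ Γ Γ') (s : S) :
    PSub ob (s :: Δ) Γ Γ' :=
  fun _ X => (σ _ X).nsub (NSub.wk s)

/-- The substitution `{Q/X}` of a term for the most recently bound process variable. -/
def PSub.single {Δ : List S} {Γ : List (Ty S)} {T : Ty S} (Q : Tm ob Δ Γ T) :
    PSub ob Δ (T :: Γ) Γ
  | _, .zero => Q
  | _, .succ X => .var X

/-- Application of a process substitution to a term. -/
def Tm.psub {Δ : List S} {Γ Γ' : List (Ty S)} {T : Ty S} (σ : PSub ob Δ Γ Γ') :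
    Tm ob Δ Γ T → Tm ob Δ Γ' T
  | .nil => .nil
  | .var X => σ _ X
  | .inp m P => .inp m (P.psub (σ.lift _))
  | .out m Q => .out m (Q.psub σ)
  | .par P Q => .par (P.psub σ) (Q.psub σ)
  | .pabs P => .pabs (P.psub (σ.lift _))
  | .papp P Q => .papp (P.psub σ) (Q.psub σ)
  | .nabs P => .nabs (P.psub (σ.nlift _))
  | .napp P n => .napp (P.psub σ) n

/-- `P{Q/X}`, where `X` is the most recently bound process variable of `P`. -/
def Tm.inst {Δ : List S} {Γ : List (Ty S)} {T U : Ty S} (P : Tm ob Δ (T :: Γ) U)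
    (Q : Tm ob Δ Γ T) : Tm ob Δ Γ U :=
  P.psub (PSub.single Q)

/-- `P{n/x}`, where `x` is the most recently bound name variable of `P`. -/
def Tm.ninst {Δ : List S} {Γ : List (Ty S)} {s : S} {U : Ty S} (P : Tm ob (s :: Δ) Γ U)
    (n : Nm Δ s) : Tm ob Δ Γ U :=
  P.nsub (NSub.single n)

/-! ### Structural congruence and transitions -/

/-- Structural congruence: the least congruence with the commutative monoid laws of parallel
composition and the two application laws. -/
inductive SC : {Δ : List S} → {Γ : List (Ty S)} → {T : Ty S} →
    Tm ob Δ Γ T → Tm ob Δ Γ T → Prop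
  | refl {Δ Γ T} (P : Tm ob Δ Γ T) : SC P P
  | symm {Δ Γ T} {P Q : Tm ob Δ Γ T} : SC P Q → SC Q P
  | trans {Δ Γ T} {P Q R : Tm ob Δ Γ T} : SC P Q → SC Q R → SC P R
  | inp {Δ Γ} {s : S} (m : Nm Δ s) {P P' : Tm ob Δ (ob s :: Γ) Ty.proc} :
      SC P P' → SC (Tm.inp m P) (Tm.inp m P')
  | out {Δ Γ} {s : S} (m : Nm Δ s) {Q Q' : Tm ob Δ Γ (ob s)} :
      SC Q Q' → SC (Tm.out m Q) (Tm.out m Q')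
  | par {Δ Γ} {P P' Q Q' : Tm ob Δ Γ Ty.proc} :
      SC P P' → SC Q Q' → SC (Tm.par P Q) (Tm.par P' Q')
  | pabs {Δ Γ T} {P P' : Tm ob Δ (T :: Γ) Ty.proc} :
      SC P P' → SC (Tm.pabs P) (Tm.pabs P')
  | papp {Δ Γ T} {P P' : Tm ob Δ Γ (Ty.pabs T)} {Q Q' : Tm ob Δ Γ T} :
      SC P P' → SC Q Q' → SC (Tm.papp P Q) (Tm.papp P' Q')
  | nabs {Δ Γ} {s : S} {P P' : Tm ob (s :: Δ) Γ Ty.proc} :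
      SC P P' → SC (Tm.nabs P) (Tm.nabs P')
  | napp {Δ Γ} {s : S} {P P' : Tm ob Δ Γ (Ty.nabs s)} (n : Nm Δ s) :
      SC P P' → SC (Tm.napp P n) (Tm.napp P' n)
  | par_assoc {Δ Γ} (P Q R : Tm ob Δ Γ Ty.proc) :
      SC (Tm.par (Tm.par P Q) R) (Tm.par P (Tm.par Q R))
  | par_comm {Δ Γ} (P Q : Tm ob Δ Γ Ty.proc) : SC (Tm.par P Q) (Tm.par Q P)
  | par_nil {Δ Γ} (P : Tm ob Δ Γ Ty.proc) : SC (Tm.par P Tm.nil) P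
  | pbeta {Δ Γ T} (P : Tm ob Δ (T :: Γ) Ty.proc) (Q : Tm ob Δ Γ T) :
      SC (Tm.papp (Tm.pabs P) Q) (P.inst Q)
  | nbeta {Δ Γ} {s : S} (P : Tm ob (s :: Δ) Γ Ty.proc) (n : Nm Δ s) :
      SC (Tm.napp (Tm.nabs P) n) (P.ninst n)

/-- Input transitions `P --m(X)--> P'`; the place-holder `X` is the new variable of `P'`. -/
inductive InStep {Δ : List S} {Γ : List (Ty S)} {s : S} (m : Nm Δ s) :
    Tm ob Δ Γ Ty.proc → Tm ob Δ (ob s :: Γ) Ty.proc → Prop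
  | inp (P : Tm ob Δ (ob s :: Γ) Ty.proc) : InStep m (Tm.inp m P) P
  | parL {P P'} (Q : Tm ob Δ Γ Ty.proc) :
      InStep m P P' → InStep m (Tm.par P Q) (Tm.par P' (Q.wk _))
  | parR {Q Q'} (P : Tm ob Δ Γ Ty.proc) :
      InStep m Q Q' → InStep m (Tm.par P Q) (Tm.par (P.wk _) Q')
  | struct {Q P P' Q'} : SC Q P → InStep m P P' → SC P' Q' → InStep m Q Q'

/-- Output transitions: `OutStep m A P P'` is `P --m̄(A)--> P'`. -/
inductive OutStep {Δ : List S} {Γ : List (Ty S)} {s : S} (m : Nm Δ s) (A : Tm ob Δ Γ (ob s)) :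
    Tm ob Δ Γ Ty.proc → Tm ob Δ Γ Ty.proc → Prop
  | out : OutStep m A (Tm.out m A) Tm.nil
  | parL {P P'} (Q : Tm ob Δ Γ Ty.proc) :
      OutStep m A P P' → OutStep m A (Tm.par P Q) (Tm.par P' Q)
  | parR {Q Q'} (P : Tm ob Δ Γ Ty.proc) :
      OutStep m A Q Q' → OutStep m A (Tm.par P Q) (Tm.par P Q')
  | struct {Q P P' Q'} : SC Q P → OutStep m A P P' → SC P' Q' → OutStep m A Q Q'

/-- Internal transitions `P --τ--> P'`. -/
inductive TauStep {Δ : List S} {Γ : List (Ty S)} :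
    Tm ob Δ Γ Ty.proc → Tm ob Δ Γ Ty.proc → Prop
  | comL {s : S} {m : Nm Δ s} {A : Tm ob Δ Γ (ob s)} {P P' Q : Tm ob Δ Γ Ty.proc}
      {Q' : Tm ob Δ (ob s :: Γ) Ty.proc} :
      OutStep m A P P' → InStep m Q Q' → TauStep (Tm.par P Q) (Tm.par P' (Q'.inst A))
  | comR {s : S} {m : Nm Δ s} {A : Tm ob Δ Γ (ob s)} {P Q Q' : Tm ob Δ Γ Ty.proc}
      {P' : Tm ob Δ (ob s :: Γ) Ty.proc} :
      InStep m P P' → OutStep m A Q Q' → TauStep (Tm.par P Q) (Tm.par (P'.inst A) Q')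
  | parL {P P'} (Q : Tm ob Δ Γ Ty.proc) :
      TauStep P P' → TauStep (Tm.par P Q) (Tm.par P' Q)
  | parR {Q Q'} (P : Tm ob Δ Γ Ty.proc) :
      TauStep Q Q' → TauStep (Tm.par P Q) (Tm.par P Q')
  | struct {Q P P' Q'} : SC Q P → TauStep P P' → SC P' Q' → TauStep Q Q'

/-! ### Strong HO-IO bisimilarity -/

/-- Reading a term of process-abstraction type as `⟨Y⟩A`, this is `A`.
A variable `X` of such a type is read as `⟨Y⟩(X⟨Y⟩)`. -/
def Tm.pbody {Δ : List S} {Γ : List (Ty S)} {T : Ty S} :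
    Tm ob Δ Γ (Ty.pabs T) → Tm ob Δ (T :: Γ) Ty.proc
  | .pabs A => A
  | .var X => .papp (.var X.succ) (.var .zero)

/-- Reading a term of name-abstraction type as `⟨y⟩A`, this is `A`.
A variable `X` of such a type is read as `⟨y⟩(X⟨y⟩)`. -/
def Tm.nbody {Δ : List S} {Γ : List (Ty S)} {s : S} :
    Tm ob Δ Γ (Ty.nabs s) → Tm ob (s :: Δ) Γ Ty.proc
  | .nabs A => A
  | .var X => .napp (.var X) (.var .zero)

/-- Strong HO-IO bisimulations. Relations hold between terms of the same type, so that a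
non-abstraction is only related to non-abstractions. -/
structure IsHOIOBisim
    (R : ∀ {Δ : List S} {Γ : List (Ty S)} {T : Ty S}, Tm ob Δ Γ T → Tm ob Δ Γ T → Prop) :
    Prop where
  symm : ∀ {Δ Γ T} {P Q : Tm ob Δ Γ T}, R P Q → R Q P
  pabs : ∀ {Δ Γ T} {P Q : Tm ob Δ Γ (Ty.pabs T)}, R P Q → R P.pbody Q.pbody
  nabs : ∀ {Δ Γ s} {P Q : Tm ob Δ Γ (Ty.nabs s)}, R P Q → R P.nbody Q.nbody
  out : ∀ {Δ Γ} {P Q : Tm ob Δ Γ Ty.proc}, R P Q →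
    ∀ {s} (m : Nm Δ s) (A : Tm ob Δ Γ (ob s)) (P' : Tm ob Δ Γ Ty.proc), OutStep m A P P' →
      ∃ (B : Tm ob Δ Γ (ob s)) (Q' : Tm ob Δ Γ Ty.proc), OutStep m B Q Q' ∧ R A B ∧ R P' Q'
  inp : ∀ {Δ Γ} {P Q : Tm ob Δ Γ Ty.proc}, R P Q →
    ∀ {s} (m : Nm Δ s) (P' : Tm ob Δ (ob s :: Γ) Ty.proc), InStep m P P' →
      ∃ Q' : Tm ob Δ (ob s :: Γ) Ty.proc, InStep m Q Q' ∧ R P' Q'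
  var : ∀ {Δ Γ} {P Q : Tm ob Δ Γ Ty.proc}, R P Q →
    ∀ (X : Var Γ Ty.proc) (P' : Tm ob Δ Γ Ty.proc), SC P (Tm.par (Tm.var X) P') →
      ∃ Q' : Tm ob Δ Γ Ty.proc, SC Q (Tm.par (Tm.var X) Q') ∧ R P' Q'
  papp : ∀ {Δ Γ} {P Q : Tm ob Δ Γ Ty.proc}, R P Q →
    ∀ {T} (X : Var Γ (Ty.pabs T)) (A : Tm ob Δ Γ T) (P' : Tm ob Δ Γ Ty.proc),
      SC P (Tm.par (Tm.papp (Tm.var X) A) P') →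
      ∃ (B : Tm ob Δ Γ T) (Q' : Tm ob Δ Γ Ty.proc),
        SC Q (Tm.par (Tm.papp (Tm.var X) B) Q') ∧ R A B ∧ R P' Q'
  napp : ∀ {Δ Γ} {P Q : Tm ob Δ Γ Ty.proc}, R P Q →
    ∀ {s} (X : Var Γ (Ty.nabs s)) (d : Nm Δ s) (P' : Tm ob Δ Γ Ty.proc),
      SC P (Tm.par (Tm.napp (Tm.var X) d) P') →
      ∃ Q' : Tm ob Δ Γ Ty.proc, SC Q (Tm.par (Tm.napp (Tm.var X) d) Q') ∧ R P' Q'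

/-- Strong HO-IO bisimilarity: the union of all strong HO-IO bisimulations. -/
def HOIOBisimilar {Δ : List S} {Γ : List (Ty S)} {T : Ty S} (P Q : Tm ob Δ Γ T) : Prop :=
  ∃ R : ∀ {Δ : List S} {Γ : List (Ty S)} {T : Ty S}, Tm ob Δ Γ T → Tm ob Δ Γ T → Prop,
    IsHOIOBisim R ∧ R P Q

/-! ### Strong HO bisimilarity -/

/-- Strong HO bisimulations, on closed terms. Relations hold between terms of the same type, so
that a non-abstraction is only related to non-abstractions. -/
structure IsHOBisim
    (R : ∀ {Δ : List S} {T : Ty S}, Tm ob Δ [] T → Tm ob Δ [] T → Prop) : Prop where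
  symm : ∀ {Δ T} {P Q : Tm ob Δ [] T}, R P Q → R Q P
  pabs : ∀ {Δ T} {P' : Tm ob Δ [T] Ty.proc} {Q : Tm ob Δ [] (Ty.pabs T)}, R (Tm.pabs P') Q →
    ∃ Q' : Tm ob Δ [T] Ty.proc, Q = Tm.pabs Q' ∧
      ∀ A : Tm ob Δ [] T, R (P'.inst A) (Q'.inst A)
  nabs : ∀ {Δ s} {A : Tm ob (s :: Δ) [] Ty.proc} {Q : Tm ob Δ [] (Ty.nabs s)},
    R (Tm.nabs A) Q → ∃ B : Tm ob (s :: Δ) [] Ty.proc, Q = Tm.nabs B ∧ R A B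
  out : ∀ {Δ} {P Q : Tm ob Δ [] Ty.proc}, R P Q →
    ∀ {s} (m : Nm Δ s) (A : Tm ob Δ [] (ob s)) (P' : Tm ob Δ [] Ty.proc), OutStep m A P P' →
      ∃ (B : Tm ob Δ [] (ob s)) (Q' : Tm ob Δ [] Ty.proc), OutStep m B Q Q' ∧ R A B ∧ R P' Q'
  inp : ∀ {Δ} {P Q : Tm ob Δ [] Ty.proc}, R P Q →
    ∀ {s} (m : Nm Δ s) (P' : Tm ob Δ [ob s] Ty.proc), InStep m P P' →
      ∃ Q' : Tm ob Δ [ob s] Ty.proc, InStep m Q Q' ∧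
        ∀ A : Tm ob Δ [] (ob s), R (P'.inst A) (Q'.inst A)
  tau : ∀ {Δ} {P Q : Tm ob Δ [] Ty.proc}, R P Q →
    ∀ P' : Tm ob Δ [] Ty.proc, TauStep P P' →
      ∃ Q' : Tm ob Δ [] Ty.proc, TauStep Q Q' ∧ R P' Q'

/-- Strong HO bisimilarity on closed terms: the union of all strong HO bisimulations. -/
def HOBisimilarClosed {Δ : List S} {T : Ty S} (P Q : Tm ob Δ [] T) : Prop :=
  ∃ R : ∀ {Δ : List S} {T : Ty S}, Tm ob Δ [] T → Tm ob Δ [] T → Prop,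
    IsHOBisim R ∧ R P Q

/-- Strong HO bisimilarity on arbitrary terms: all closed instantiations of the free process
variables are strong HO bisimilar. -/
def HOBisimilar {Δ : List S} {Γ : List (Ty S)} {T : Ty S} (P Q : Tm ob Δ Γ T) : Prop :=
  ∀ σ : PSub ob Δ Γ [], HOBisimilarClosed (P.psub σ) (Q.psub σ)

end

end HOmp

namespace HOmp

universe u

variable {S : Type u} {ob : S → Ty S}

/-! ### The substitution calculus -/

/-! The first task is to see through structural congruence. A Kripke logical relation indexed by
types (`LR`, `NormSC`) shows that head reduction of every process ends in a multiset of prime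
components (inputs, outputs, variables, applied variables, with subterms modulo congruence), and
that congruent processes have the same multiset (`NormSC.subRel_of_sc`). Congruence of processes
becomes equality of multisets (`Tm.comps_eq_iff`), and a transition removes a component. The same
argument gives every term a size, that of its η-long normal form.

HO-IO bisimilarity implies HO bisimilarity once it is substitutive (`HOIOBisimilar.psub`). A τ-step
is an output followed by an input of the emitted term; the HO-IO game answers both, and
substitutivity recombines the answers. Substitutivity is proved with a second logical relation, over
bisimilarity itself, by induction on size (`HOIOBisimilar.subRel_of_sz`). The redexes created by a
substitution are handled by the logical relation, so the induction is only on the term before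
substitution. Since the HO-IO game has no τ-clause, closure under renaming and parallel composition
is easy.

Conversely, let two terms be HO bisimilar under all closed instantiations. Substitute for each free
variable a trigger: a closed term that outputs its argument, or an encoding of it, at a constant of
its own. Since `ob` is onto, there is a name able to carry each argument. An output at such a
constant reveals the head variable and its argument, so the HO game on the instances simulates the
HO-IO game on the open terms. The constants must be fresh. Instead of bounding those of the terms,
the candidate relation asks for bisimilarity for infinitely many starting indices `N` (`TrigRel`). A
fixed constant collides with a given trigger for at most one `N`, and since an answer is one of
finitely many components, some answer works for infinitely many `N`. -/

def NSub.id (Δ : List S) : NSub Δ Δ := fun _ x => .var x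

def NSub.comp {Δ Δ' Δ'' : List S} (ρ : NSub Δ Δ') (ρ' : NSub Δ' Δ'') : NSub Δ Δ'' :=
  fun s x => (ρ s x).nsub ρ'

theorem NSub.ext {Δ Δ' : List S} {ρ ρ' : NSub Δ Δ'} (h : ∀ s x, ρ s x = ρ' s x) : ρ = ρ' :=
  funext fun s => funext fun x => h s x

theorem PSub.ext {Δ : List S} {Γ Γ' : List (Ty S)} {σ σ' : PSub ob Δ Γ Γ'}
    (h : ∀ T X, σ T X = σ' T X) : σ = σ' :=
  funext fun T => funext fun X => h T X

theorem Nm.nsub_nsub {Δ Δ' Δ'' : List S} (ρ : NSub Δ Δ') (ρ' : NSub Δ' Δ'') {s : S}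
    (n : Nm Δ s) : (n.nsub ρ).nsub ρ' = n.nsub (ρ.comp ρ') := by
  cases n <;> rfl

theorem Nm.nsub_id {Δ : List S} {s : S} (n : Nm Δ s) : n.nsub (NSub.id Δ) = n := by
  cases n <;> rfl

theorem NSub.lift_id {Δ : List S} (s : S) : (NSub.id Δ).lift s = NSub.id (s :: Δ) := by
  apply NSub.ext
  rintro _ (_ | x) <;> rfl

theorem NSub.lift_comp {Δ Δ' Δ'' : List S} (ρ : NSub Δ Δ') (ρ' : NSub Δ' Δ'') (s : S) :
    (ρ.lift s).comp (ρ'.lift s) = (ρ.comp ρ').lift s := by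
  apply NSub.ext
  rintro _ (_ | x)
  · rfl
  · simp only [NSub.comp, NSub.lift, Nm.nsub_nsub]
    rfl

theorem NSub.wk_comp_lift {Δ Δ' : List S} (ρ : NSub Δ Δ') (s : S) :
    (NSub.wk s).comp (ρ.lift s) = ρ.comp (NSub.wk s) := by
  apply NSub.ext
  intro t x
  rfl

theorem NSub.wk_comp_single {Δ : List S} {s : S} (n : Nm Δ s) :
    (NSub.wk s).comp (NSub.single n) = NSub.id Δ := by
  apply NSub.ext
  intro t x
  rfl

theorem NSub.comp_id {Δ Δ' : List S} (ρ : NSub Δ Δ') : ρ.comp (NSub.id Δ') = ρ := by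
  apply NSub.ext
  intro t x
  simp [NSub.comp, Nm.nsub_id]

theorem NSub.id_comp {Δ Δ' : List S} (ρ : NSub Δ Δ') : (NSub.id Δ).comp ρ = ρ := rfl

/-- Extension of a name substitution by an image for a new name variable. -/
def NSub.cons {Δ Δ' : List S} {s : S} (n : Nm Δ' s) (ρ : NSub Δ Δ') : NSub (s :: Δ) Δ'
  | _, .zero => n
  | _, .succ x => ρ _ x

theorem NSub.lift_comp_single {Δ Δ' : List S} {s : S} (ρ : NSub Δ Δ') (n : Nm Δ' s) :
    (ρ.lift s).comp (NSub.single n) = NSub.cons n ρ := by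
  apply NSub.ext
  rintro _ (_ | x)
  · rfl
  · simp [NSub.comp, NSub.lift, NSub.cons, Nm.nsub_nsub, NSub.wk_comp_single, Nm.nsub_id]

theorem NSub.single_comp {Δ Δ' : List S} {s : S} (n : Nm Δ s) (ρ : NSub Δ Δ') :
    (NSub.single n).comp ρ = NSub.cons (n.nsub ρ) ρ := by
  apply NSub.ext
  rintro _ (_ | x) <;> rfl

theorem Tm.nsub_nsub {Δ Δ' Δ'' : List S} {Γ : List (Ty S)} {T : Ty S} (ρ : NSub Δ Δ')
    (ρ' : NSub Δ' Δ'') (P : Tm ob Δ Γ T) : (P.nsub ρ).nsub ρ' = P.nsub (ρ.comp ρ') := by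
  induction P generalizing Δ' Δ'' <;>
    simp_all [Tm.nsub, Nm.nsub_nsub, NSub.lift_comp]

theorem Tm.nsub_id {Δ : List S} {Γ : List (Ty S)} {T : Ty S} (P : Tm ob Δ Γ T) :
    P.nsub (NSub.id Δ) = P := by
  induction P <;> simp_all [Tm.nsub, Nm.nsub_id, NSub.lift_id]

/-- A renaming as a substitution. -/
def PSub.ofRen (ob : S → Ty S) (Δ : List S) {Γ Γ' : List (Ty S)} (r : Ren Γ Γ') :
    PSub ob Δ Γ Γ' :=
  fun _ X => .var (r _ X)

def PSub.id (ob : S → Ty S) (Δ : List S) (Γ : List (Ty S)) : PSub ob Δ Γ Γ := fun _ X => .var X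

theorem PSub.lift_ofRen {Δ : List S} {Γ Γ' : List (Ty S)} (r : Ren Γ Γ') (T : Ty S) :
    (PSub.ofRen ob Δ r).lift T = PSub.ofRen ob Δ (r.lift T) := by
  apply PSub.ext
  rintro _ (_ | X) <;> rfl

theorem Tm.ren_eq_psub {Δ : List S} {Γ Γ' : List (Ty S)} {T : Ty S} (r : Ren Γ Γ')
    (P : Tm ob Δ Γ T) : P.ren r = P.psub (PSub.ofRen ob Δ r) := by
  induction P generalizing Γ' <;> simp_all [Tm.ren, Tm.psub, PSub.lift_ofRen] <;> rfl

theorem Tm.nsub_ren {Δ Δ' : List S} {Γ Γ' : List (Ty S)} {T : Ty S} (r : Ren Γ Γ')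
    (ρ : NSub Δ Δ') (P : Tm ob Δ Γ T) : (P.ren r).nsub ρ = (P.nsub ρ).ren r := by
  induction P generalizing Γ' Δ' <;> simp_all [Tm.ren, Tm.nsub]

/-- The composition laws for renamings and substitutions come in this order because the earlier laws
supply the binder cases of the later ones. -/
theorem Tm.psub_ren {Δ : List S} {Γ Γ' Γ'' : List (Ty S)} {T : Ty S} (r : Ren Γ Γ')
    (σ : PSub ob Δ Γ' Γ'') (P : Tm ob Δ Γ T) :
    (P.ren r).psub σ = P.psub (fun U X => σ U (r U X)) := by
  have hl : ∀ {Δ : List S} {Γ Γ' Γ'' : List (Ty S)} (r : Ren Γ Γ') (σ : PSub ob Δ Γ' Γ'')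
      (T : Ty S), (fun U X => σ.lift T U (r.lift T U X)) =
        PSub.lift (ob := ob) (fun U X => σ U (r U X)) T := by
    intro Δ Γ Γ' Γ'' r σ T
    apply PSub.ext
    rintro _ (_ | X) <;> rfl
  induction P generalizing Γ' Γ'' with
  | inp m P ih => simp [Tm.ren, Tm.psub, ih, hl]
  | pabs P ih => simp [Tm.ren, Tm.psub, ih, hl]
  | nabs P ih => simp only [Tm.ren, Tm.psub, ih]; rfl
  | _ => simp_all [Tm.ren, Tm.psub]

theorem Tm.ren_ren {Δ : List S} {Γ Γ' Γ'' : List (Ty S)} {T : Ty S} (r : Ren Γ Γ')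
    (r' : Ren Γ' Γ'') (P : Tm ob Δ Γ T) :
    (P.ren r).ren r' = P.ren (fun U X => r' U (r U X)) := by
  rw [Tm.ren_eq_psub r', Tm.psub_ren]
  exact (Tm.ren_eq_psub _ _).symm

theorem Tm.wk_ren_lift {Δ : List S} {Γ Γ' : List (Ty S)} {T U : Ty S} (r : Ren Γ Γ')
    (P : Tm ob Δ Γ T) : (P.wk U).ren (r.lift U) = (P.ren r).wk U := by
  simp only [Tm.wk, Tm.ren_ren]
  rfl

theorem Tm.ren_psub {Δ : List S} {Γ Γ' Γ'' : List (Ty S)} {T : Ty S} (σ : PSub ob Δ Γ Γ')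
    (r : Ren Γ' Γ'') (P : Tm ob Δ Γ T) :
    (P.psub σ).ren r = P.psub (fun U X => (σ U X).ren r) := by
  have hl : ∀ {Δ : List S} {Γ Γ' Γ'' : List (Ty S)} (σ : PSub ob Δ Γ Γ') (r : Ren Γ' Γ'')
      (T : Ty S), (fun U X => (σ.lift T U X).ren (r.lift T)) =
        PSub.lift (ob := ob) (fun U X => (σ U X).ren r) T := by
    intro Δ Γ Γ' Γ'' σ r T
    apply PSub.ext
    rintro _ (_ | X)
    · rfl
    · exact Tm.wk_ren_lift _ _
  induction P generalizing Γ' Γ'' with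
  | inp m P ih => simp [Tm.ren, Tm.psub, ih, hl]
  | pabs P ih => simp [Tm.ren, Tm.psub, ih, hl]
  | nabs P ih =>
    simp only [Tm.ren, Tm.psub, ih]
    congr 2
    apply PSub.ext
    intro U X
    exact (Tm.nsub_ren _ _ _).symm
  | _ => simp_all [Tm.ren, Tm.psub]

theorem Tm.nsub_psub {Δ Δ' : List S} {Γ Γ' : List (Ty S)} {T : Ty S} (σ : PSub ob Δ Γ Γ')
    (ρ : NSub Δ Δ') (P : Tm ob Δ Γ T) :
    (P.psub σ).nsub ρ = (P.nsub ρ).psub (fun U X => (σ U X).nsub ρ) := by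
  have hl : ∀ {Δ Δ' : List S} {Γ Γ' : List (Ty S)} (σ : PSub ob Δ Γ Γ') (ρ : NSub Δ Δ')
      (T : Ty S), (fun U X => (σ.lift T U X).nsub ρ) =
        PSub.lift (ob := ob) (fun U X => (σ U X).nsub ρ) T := by
    intro Δ Δ' Γ Γ' σ ρ T
    apply PSub.ext
    rintro _ (_ | X)
    · rfl
    · exact Tm.nsub_ren _ _ _
  induction P generalizing Γ' Δ' with
  | inp m P ih => simp [Tm.nsub, Tm.psub, ih, hl]
  | pabs P ih => simp [Tm.nsub, Tm.psub, ih, hl]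
  | nabs P ih =>
    simp only [Tm.nsub, Tm.psub, ih]
    congr 2
    apply PSub.ext
    intro U X
    simp only [PSub.nlift, Tm.nsub_nsub, NSub.wk_comp_lift]
  | _ => simp_all [Tm.nsub, Tm.psub]

theorem Tm.psub_psub {Δ : List S} {Γ Γ' Γ'' : List (Ty S)} {T : Ty S} (σ : PSub ob Δ Γ Γ')
    (σ' : PSub ob Δ Γ' Γ'') (P : Tm ob Δ Γ T) :
    (P.psub σ).psub σ' = P.psub (fun U X => (σ U X).psub σ') := by
  have hl : ∀ {Δ : List S} {Γ Γ' Γ'' : List (Ty S)} (σ : PSub ob Δ Γ Γ')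
      (σ' : PSub ob Δ Γ' Γ'') (T : Ty S), (fun U X => (σ.lift T U X).psub (σ'.lift T)) =
        PSub.lift (ob := ob) (fun U X => (σ U X).psub σ') T := by
    intro Δ Γ Γ' Γ'' σ σ' T
    apply PSub.ext
    rintro _ (_ | X)
    · rfl
    · simp only [PSub.lift, Tm.wk, Tm.psub_ren, Tm.ren_psub]
      rfl
  induction P generalizing Γ' Γ'' with
  | inp m P ih => simp [Tm.psub, ih, hl]
  | pabs P ih => simp [Tm.psub, ih, hl]
  | nabs P ih =>
    simp only [Tm.psub, ih]
    congr 2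
    apply PSub.ext
    intro U X
    exact (Tm.nsub_psub _ _ _).symm
  | _ => simp_all [Tm.psub]

theorem Tm.psub_id {Δ : List S} {Γ : List (Ty S)} {T : Ty S} (P : Tm ob Δ Γ T) :
    P.psub (PSub.id ob Δ Γ) = P := by
  have hl : ∀ {Δ : List S} {Γ : List (Ty S)} (T : Ty S),
      (PSub.id ob Δ Γ).lift T = PSub.id ob Δ (T :: Γ) := by
    intro Δ Γ T
    apply PSub.ext
    rintro _ (_ | X) <;> rfl
  induction P with
  | nabs P ih => exact congrArg Tm.nabs ih
  | var X => rfl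
  | _ => simp_all [Tm.psub]

/-- Application of a name substitution followed by a process substitution. -/
def Tm.sub {Δ Δ' : List S} {Γ Γ' : List (Ty S)} {T : Ty S} (ρ : NSub Δ Δ')
    (σ : PSub ob Δ' Γ Γ') (P : Tm ob Δ Γ T) : Tm ob Δ' Γ' T :=
  (P.nsub ρ).psub σ

/-- Postcomposition of a process substitution. -/
def PSub.andThen {Δ Δ' : List S} {Γ Γ' Γ'' : List (Ty S)} (σ : PSub ob Δ Γ Γ')
    (ρ : NSub Δ Δ') (σ' : PSub ob Δ' Γ' Γ'') : PSub ob Δ' Γ Γ'' :=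
  fun _ X => (σ _ X).sub ρ σ'

/-- Pairs of a name substitution and a process substitution compose. The commutation laws with
`inst`, `ninst` and weakening below reduce to comparing composites on variables. -/
theorem Tm.sub_sub {Δ Δ' Δ'' : List S} {Γ Γ' Γ'' : List (Ty S)} {T : Ty S} (ρ : NSub Δ Δ')
    (σ : PSub ob Δ' Γ Γ') (ρ' : NSub Δ' Δ'') (σ' : PSub ob Δ'' Γ' Γ'') (P : Tm ob Δ Γ T) :
    (P.sub ρ σ).sub ρ' σ' = P.sub (ρ.comp ρ') (σ.andThen ρ' σ') := by
  simp only [Tm.sub, Tm.nsub_psub, Tm.nsub_nsub]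
  exact Tm.psub_psub _ _ _

theorem Tm.sub_id {Δ : List S} {Γ : List (Ty S)} {T : Ty S} (P : Tm ob Δ Γ T) :
    P.sub (NSub.id Δ) (PSub.id ob Δ Γ) = P := by
  simp [Tm.sub, Tm.nsub_id, Tm.psub_id]

theorem Tm.psub_eq_sub {Δ : List S} {Γ Γ' : List (Ty S)} {T : Ty S} (σ : PSub ob Δ Γ Γ')
    (P : Tm ob Δ Γ T) : P.psub σ = P.sub (NSub.id Δ) σ := by
  simp [Tm.sub, Tm.nsub_id]

theorem Tm.nsub_eq_sub {Δ Δ' : List S} {Γ : List (Ty S)} {T : Ty S} (ρ : NSub Δ Δ')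
    (P : Tm ob Δ Γ T) : P.nsub ρ = P.sub ρ (PSub.id ob Δ' Γ) := by
  simp [Tm.sub, Tm.psub_id]

theorem Tm.ren_eq_sub {Δ : List S} {Γ Γ' : List (Ty S)} {T : Ty S} (r : Ren Γ Γ')
    (P : Tm ob Δ Γ T) : P.ren r = P.sub (NSub.id Δ) (PSub.ofRen ob Δ r) := by
  rw [Tm.ren_eq_psub, Tm.psub_eq_sub]

/-- Extension of a process substitution by an image for a new process variable. -/
def PSub.cons {Δ : List S} {Γ Γ' : List (Ty S)} {T : Ty S} (A : Tm ob Δ Γ' T)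
    (σ : PSub ob Δ Γ Γ') : PSub ob Δ (T :: Γ) Γ'
  | _, .zero => A
  | _, .succ X => σ _ X

theorem Tm.inst_sub_lift {Δ Δ' : List S} {Γ Γ' : List (Ty S)} {T U : Ty S} (ρ : NSub Δ Δ')
    (σ : PSub ob Δ' Γ Γ') (P : Tm ob Δ (T :: Γ) U) (A : Tm ob Δ' Γ' T) :
    (P.sub ρ (σ.lift T)).inst A = P.sub ρ (PSub.cons A σ) := by
  simp only [Tm.inst, Tm.sub, Tm.psub_psub]
  congr 1
  apply PSub.ext
  rintro _ (_ | X)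
  · rfl
  · simp only [PSub.lift, Tm.wk, Tm.psub_ren, PSub.cons]
    exact Tm.psub_id _

theorem Tm.sub_inst {Δ Δ' : List S} {Γ Γ' : List (Ty S)} {T U : Ty S} (ρ : NSub Δ Δ')
    (σ : PSub ob Δ' Γ Γ') (P : Tm ob Δ (T :: Γ) U) (A : Tm ob Δ Γ T) :
    (P.inst A).sub ρ σ = P.sub ρ (PSub.cons (A.sub ρ σ) σ) := by
  simp only [Tm.inst, Tm.psub_eq_sub, Tm.sub_sub, NSub.id_comp]
  congr 1
  apply PSub.ext
  rintro _ (_ | X) <;> rfl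

theorem Tm.ninst_sub_lift {Δ Δ' : List S} {Γ Γ' : List (Ty S)} {s : S} {U : Ty S}
    (ρ : NSub Δ Δ') (σ : PSub ob Δ' Γ Γ') (P : Tm ob (s :: Δ) Γ U) (n : Nm Δ' s) :
    (P.sub (ρ.lift s) (σ.nlift s)).ninst n = P.sub (NSub.cons n ρ) σ := by
  simp only [Tm.ninst, Tm.nsub_eq_sub, Tm.sub_sub, NSub.lift_comp_single]
  congr 1
  apply PSub.ext
  intro T X
  simp only [PSub.andThen, PSub.nlift, Tm.nsub_eq_sub, Tm.sub_sub, NSub.wk_comp_single]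
  exact Tm.sub_id _

theorem Tm.sub_ninst {Δ Δ' : List S} {Γ Γ' : List (Ty S)} {s : S} {U : Ty S} (ρ : NSub Δ Δ')
    (σ : PSub ob Δ' Γ Γ') (P : Tm ob (s :: Δ) Γ U) (n : Nm Δ s) :
    (P.ninst n).sub ρ σ = P.sub (NSub.cons (n.nsub ρ) ρ) σ := by
  simp only [Tm.ninst, Tm.nsub_eq_sub, Tm.sub_sub, NSub.single_comp]
  rfl

theorem Tm.wk_sub_lift {Δ Δ' : List S} {Γ Γ' : List (Ty S)} {T U : Ty S} (ρ : NSub Δ Δ')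
    (σ : PSub ob Δ' Γ Γ') (P : Tm ob Δ Γ U) :
    (P.wk T).sub ρ (σ.lift T) = (P.sub ρ σ).wk T := by
  simp only [Tm.wk, Tm.ren_eq_sub, Tm.sub_sub, NSub.id_comp, NSub.comp_id]
  congr 1
  apply PSub.ext
  intro V X
  exact Tm.ren_eq_sub _ _

theorem Tm.wk_inst {Δ : List S} {Γ : List (Ty S)} {T U : Ty S} (P : Tm ob Δ Γ U)
    (A : Tm ob Δ Γ T) : (P.wk T).inst A = P := by
  simp only [Tm.wk, Tm.inst, Tm.psub_ren]
  exact Tm.psub_id _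

/-! ### Bodies of abstractions -/

/-- For an abstraction this is β; for a variable, the reading `⟨Y⟩(X⟨Y⟩)` makes both sides the same
term. -/
theorem SC.papp_pbody {Δ Δ' : List S} {Γ Γ' : List (Ty S)} {T : Ty S} (ρ : NSub Δ Δ')
    (σ : PSub ob Δ' Γ Γ') (P : Tm ob Δ Γ (Ty.pabs T)) (A : Tm ob Δ' Γ' T) :
    SC (Tm.papp (P.sub ρ σ) A) (P.pbody.sub ρ (PSub.cons A σ)) := by
  cases P with
  | pabs C =>
    have h := SC.pbeta (C.sub ρ (σ.lift T)) A
    rwa [Tm.inst_sub_lift] at h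
  | var X => exact SC.refl _

theorem SC.napp_nbody {Δ Δ' : List S} {Γ Γ' : List (Ty S)} {s : S} (ρ : NSub Δ Δ')
    (σ : PSub ob Δ' Γ Γ') (P : Tm ob Δ Γ (Ty.nabs s)) (n : Nm Δ' s) :
    SC (Tm.napp (P.sub ρ σ) n) (P.nbody.sub (NSub.cons n ρ) σ) := by
  cases P with
  | nabs C =>
    have h := SC.nbeta (C.sub (ρ.lift s) (σ.nlift s)) n
    rwa [Tm.ninst_sub_lift] at h
  | var X => exact SC.refl _

theorem PSub.cons_zero_wk {Δ : List S} {Γ : List (Ty S)} (T : Ty S) :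
    PSub.cons (Tm.var .zero) (PSub.ofRen ob Δ (Ren.wk T)) = PSub.id ob Δ (T :: Γ) := by
  apply PSub.ext
  rintro _ (_ | X) <;> rfl

theorem NSub.cons_zero_wk {Δ : List S} (s : S) :
    NSub.cons (Nm.var .zero) (NSub.wk s) = NSub.id (s :: Δ) := by
  apply NSub.ext
  rintro _ (_ | X) <;> rfl

theorem SC.papp_wk_zero {Δ : List S} {Γ : List (Ty S)} {T : Ty S} (P : Tm ob Δ Γ (Ty.pabs T)) :
    SC (Tm.papp (P.wk T) (Tm.var .zero)) P.pbody := by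
  have h := SC.papp_pbody (NSub.id Δ) (PSub.ofRen ob Δ (Ren.wk T)) P (Tm.var .zero)
  rwa [PSub.cons_zero_wk, Tm.sub_id, ← Tm.ren_eq_sub] at h

theorem SC.napp_wk_zero {Δ : List S} {Γ : List (Ty S)} {s : S} (P : Tm ob Δ Γ (Ty.nabs s)) :
    SC (Tm.napp (P.nsub (NSub.wk s)) (Nm.var .zero)) P.nbody := by
  have h := SC.napp_nbody (NSub.wk s) (PSub.id ob (s :: Δ) Γ) P (Nm.var .zero)
  rwa [NSub.cons_zero_wk, Tm.sub_id, ← Tm.nsub_eq_sub] at h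

/-- Substituting an abstraction into the η-expanded reading of a variable creates a redex, hence a
congruence and not an equality. -/
theorem SC.sub_pbody {Δ Δ' : List S} {Γ Γ' : List (Ty S)} {T : Ty S} (ρ : NSub Δ Δ')
    (σ : PSub ob Δ' Γ Γ') (P : Tm ob Δ Γ (Ty.pabs T)) :
    SC (P.sub ρ σ).pbody (P.pbody.sub ρ (σ.lift T)) := by
  cases P with
  | pabs C => exact SC.refl _
  | var X => exact (SC.papp_wk_zero _).symm

theorem SC.sub_nbody {Δ Δ' : List S} {Γ Γ' : List (Ty S)} {s : S} (ρ : NSub Δ Δ')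
    (σ : PSub ob Δ' Γ Γ') (P : Tm ob Δ Γ (Ty.nabs s)) :
    SC (P.sub ρ σ).nbody (P.nbody.sub (ρ.lift s) (σ.nlift s)) := by
  cases P with
  | nabs C => exact SC.refl _
  | var X => exact (SC.napp_wk_zero _).symm

/-- The bodies of two terms, if these are abstractions, are structurally congruent. -/
def BodySC {Δ : List S} {Γ : List (Ty S)} : {T : Ty S} → Tm ob Δ Γ T → Tm ob Δ Γ T → Prop
  | .proc, _, _ => True
  | .pabs _, P, Q => SC P.pbody Q.pbody
  | .nabs _, P, Q => SC P.nbody Q.nbody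

/-- There is no η-law and applications are processes, so at abstraction types congruence is
generated by the equivalence rules and the congruence rules for abstractions. Abstraction is
therefore injective modulo congruence. -/
theorem SC.bodySC {Δ : List S} {Γ : List (Ty S)} {T : Ty S} {P Q : Tm ob Δ Γ T} (h : SC P Q) :
    BodySC P Q := by
  induction h with
  | @refl Δ Γ T P => cases T <;> first | trivial | exact SC.refl _
  | @symm Δ Γ T P Q _ ih => cases T <;> first | trivial | exact SC.symm ih
  | @trans Δ Γ T P Q R _ _ ih ih' => cases T <;> first | trivial | exact SC.trans ih ih'
  | pabs h => exact h
  | nabs h => exact h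
  | _ => trivial

theorem SC.pbody {Δ : List S} {Γ : List (Ty S)} {T : Ty S} {P Q : Tm ob Δ Γ (Ty.pabs T)}
    (h : SC P Q) : SC P.pbody Q.pbody := h.bodySC

theorem SC.nbody {Δ : List S} {Γ : List (Ty S)} {s : S} {P Q : Tm ob Δ Γ (Ty.nabs s)}
    (h : SC P Q) : SC P.nbody Q.nbody := h.bodySC

/-! ### Prime components and evaluation -/

instance scSetoid (ob : S → Ty S) (Δ : List S) (Γ : List (Ty S)) (T : Ty S) :
    Setoid (Tm ob Δ Γ T) :=
  ⟨SC, SC.refl, SC.symm, SC.trans⟩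

/-- Terms up to structural congruence. -/
abbrev Cl (ob : S → Ty S) (Δ : List S) (Γ : List (Ty S)) (T : Ty S) : Type u :=
  Quotient (scSetoid ob Δ Γ T)

def Tm.cl {Δ : List S} {Γ : List (Ty S)} {T : Ty S} (P : Tm ob Δ Γ T) : Cl ob Δ Γ T :=
  Quotient.mk _ P

theorem Tm.cl_eq {Δ : List S} {Γ : List (Ty S)} {T : Ty S} {P Q : Tm ob Δ Γ T} :
    P.cl = Q.cl ↔ SC P Q := Quotient.eq

theorem Cl.exists_rep' {Δ : List S} {Γ : List (Ty S)} {T : Ty S} (a : Cl ob Δ Γ T) :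
    ∃ A : Tm ob Δ Γ T, A.cl = a := Quotient.exists_rep a

/-- The prime components of a process: inputs, outputs, variables and applied variables, with
subterms taken up to structural congruence. -/
inductive Pr (ob : S → Ty S) (Δ : List S) (Γ : List (Ty S)) : Type u
  | out {s : S} (m : Nm Δ s) (a : Cl ob Δ Γ (ob s)) : Pr ob Δ Γ
  | inp {s : S} (m : Nm Δ s) (p : Cl ob Δ (ob s :: Γ) Ty.proc) : Pr ob Δ Γ
  | var (X : Var Γ Ty.proc) : Pr ob Δ Γ
  | papp {T : Ty S} (X : Var Γ (Ty.pabs T)) (a : Cl ob Δ Γ T) : Pr ob Δ Γ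
  | napp {s : S} (X : Var Γ (Ty.nabs s)) (d : Nm Δ s) : Pr ob Δ Γ

/-- Evaluation of a process to the multiset of its prime components, by head reduction. -/
inductive Ev {Δ : List S} {Γ : List (Ty S)} :
    {T : Ty S} → Tm ob Δ Γ T → Multiset (Pr ob Δ Γ) → Prop
  | nil : Ev Tm.nil 0
  | par {P Q : Tm ob Δ Γ Ty.proc} {a b : Multiset (Pr ob Δ Γ)} :
      Ev P a → Ev Q b → Ev (Tm.par P Q) (a + b)
  | out {s : S} (m : Nm Δ s) (A : Tm ob Δ Γ (ob s)) : Ev (Tm.out m A) {Pr.out m A.cl}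
  | inp {s : S} (m : Nm Δ s) (P : Tm ob Δ (ob s :: Γ) Ty.proc) :
      Ev (Tm.inp m P) {Pr.inp m P.cl}
  | var (X : Var Γ Ty.proc) : Ev (Tm.var X) {Pr.var X}
  | papp {T : Ty S} (X : Var Γ (Ty.pabs T)) (A : Tm ob Δ Γ T) :
      Ev (Tm.papp (Tm.var X) A) {Pr.papp X A.cl}
  | napp {s : S} (X : Var Γ (Ty.nabs s)) (d : Nm Δ s) :
      Ev (Tm.napp (Tm.var X) d) {Pr.napp X d}
  | pbeta {T : Ty S} {P : Tm ob Δ (T :: Γ) Ty.proc} {A : Tm ob Δ Γ T}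
      {a : Multiset (Pr ob Δ Γ)} : Ev (P.inst A) a → Ev (Tm.papp (Tm.pabs P) A) a
  | nbeta {s : S} {P : Tm ob (s :: Δ) Γ Ty.proc} {n : Nm Δ s}
      {a : Multiset (Pr ob Δ Γ)} : Ev (P.ninst n) a → Ev (Tm.napp (Tm.nabs P) n) a

theorem Ev.det {Δ : List S} {Γ : List (Ty S)} {T : Ty S} {P : Tm ob Δ Γ T}
    {a b : Multiset (Pr ob Δ Γ)} (h : Ev P a) (h' : Ev P b) : a = b := by
  induction h generalizing b with
  | par _ _ ih ih' => cases h' with | par h1 h2 => rw [ih h1, ih' h2]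
  | pbeta _ ih => cases h' with | pbeta h => exact ih h
  | nbeta _ ih => cases h' with | nbeta h => exact ih h
  | _ => cases h'; rfl

/-- `Sz n P`: the eta-long normal form of `P` has size `n`. -/
inductive Sz : {Δ : List S} → {Γ : List (Ty S)} → {T : Ty S} → ℕ → Tm ob Δ Γ T → Prop
  | struct {Δ Γ T n} {P Q : Tm ob Δ Γ T} : SC P Q → Sz n P → Sz n Q
  | nil {Δ Γ} : Sz 0 (Tm.nil : Tm ob Δ Γ Ty.proc)
  | par {Δ Γ k n} {P Q : Tm ob Δ Γ Ty.proc} : Sz k P → Sz n Q → Sz (k + n) (Tm.par P Q)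
  | inp {Δ Γ n} {s : S} (m : Nm Δ s) {P : Tm ob Δ (ob s :: Γ) Ty.proc} :
      Sz n P → Sz (n + 1) (Tm.inp m P)
  | out {Δ Γ n} {s : S} (m : Nm Δ s) {A : Tm ob Δ Γ (ob s)} : Sz n A → Sz (n + 1) (Tm.out m A)
  | var {Δ Γ} (X : Var Γ Ty.proc) : Sz 1 (Tm.var X : Tm ob Δ Γ Ty.proc)
  | papp {Δ Γ n} {T : Ty S} (X : Var Γ (Ty.pabs T)) {A : Tm ob Δ Γ T} :
      Sz n A → Sz (n + 1) (Tm.papp (Tm.var X) A)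
  | napp {Δ Γ} {s : S} (X : Var Γ (Ty.nabs s)) (d : Nm Δ s) :
      Sz 1 (Tm.napp (Tm.var X) d : Tm ob Δ Γ Ty.proc)
  | pabs {Δ Γ n} {T : Ty S} {P : Tm ob Δ Γ (Ty.pabs T)} : Sz n P.pbody → Sz (n + 1) P
  | nabs {Δ Γ n} {s : S} {P : Tm ob Δ Γ (Ty.nabs s)} : Sz n P.nbody → Sz (n + 1) P

/-- The argument in the η-expansion of a variable is a variable of a smaller type. -/
theorem Sz.exists_var {Δ : List S} {Γ : List (Ty S)} {T : Ty S} (X : Var Γ T) :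
    ∃ n, Sz n (Tm.var X : Tm ob Δ Γ T) := by
  induction T generalizing Γ with
  | proc => exact ⟨1, Sz.var X⟩
  | pabs T ih =>
    obtain ⟨n, hn⟩ := ih (Γ := T :: Γ) Var.zero
    exact ⟨_, Sz.pabs (Sz.papp X.succ hn)⟩
  | nabs s => exact ⟨_, Sz.nabs (Sz.napp X _)⟩

/-! ### Kripke logical relations -/

/-- Type-indexed relations on open terms. -/
abbrev TRel (ob : S → Ty S) : Type u :=
  ∀ ⦃Δ : List S⦄ ⦃Γ : List (Ty S)⦄ ⦃T : Ty S⦄, Tm ob Δ Γ T → Tm ob Δ Γ T → Prop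

/-- The Kripke logical relation over a base relation `B`. -/
def LR (B : TRel ob) : (T : Ty S) → {Δ : List S} → {Γ : List (Ty S)} →
    Tm ob Δ Γ T → Tm ob Δ Γ T → Prop
  | .proc, Δ, Γ, P, Q => ∀ (Δ' : List S) (Γ' : List (Ty S)) (ρ : NSub Δ Δ') (r : Ren Γ Γ'),
      B (P.sub ρ (PSub.ofRen ob Δ' r)) (Q.sub ρ (PSub.ofRen ob Δ' r))
  | .pabs T, Δ, Γ, P, Q => ∀ (Δ' : List S) (Γ' : List (Ty S)) (ρ : NSub Δ Δ') (r : Ren Γ Γ'),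
      B (P.sub ρ (PSub.ofRen ob Δ' r)) (Q.sub ρ (PSub.ofRen ob Δ' r)) ∧
      ∀ A A' : Tm ob Δ' Γ' T, LR B T A A' →
        B (Tm.papp (P.sub ρ (PSub.ofRen ob Δ' r)) A) (Tm.papp (Q.sub ρ (PSub.ofRen ob Δ' r)) A')
  | .nabs s, Δ, Γ, P, Q => ∀ (Δ' : List S) (Γ' : List (Ty S)) (ρ : NSub Δ Δ') (r : Ren Γ Γ'),
      B (P.sub ρ (PSub.ofRen ob Δ' r)) (Q.sub ρ (PSub.ofRen ob Δ' r)) ∧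
      ∀ n : Nm Δ' s,
        B (Tm.napp (P.sub ρ (PSub.ofRen ob Δ' r)) n) (Tm.napp (Q.sub ρ (PSub.ofRen ob Δ' r)) n)

section LR

variable {B : TRel ob} {Δ Δ' : List S} {Γ Γ' : List (Ty S)}

theorem LR.mono {T : Ty S} {P Q : Tm ob Δ Γ T} (h : LR B T P Q) (ρ : NSub Δ Δ')
    (r : Ren Γ Γ') :
    LR B T (P.sub ρ (PSub.ofRen ob Δ' r)) (Q.sub ρ (PSub.ofRen ob Δ' r)) := by
  cases T <;> intro Δ'' Γ'' ρ' r' <;> simp only [Tm.sub_sub] <;>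
    exact h Δ'' Γ'' (ρ.comp ρ') (fun _ X => r' _ (r _ X))

theorem LR.base {T : Ty S} {P Q : Tm ob Δ Γ T} (h : LR B T P Q) : B P Q := by
  have hid : ∀ R : Tm ob Δ Γ T, R.sub (NSub.id Δ) (PSub.ofRen ob Δ fun _ X => X) = R :=
    fun R => Tm.sub_id R
  cases T with
  | proc => have := h Δ Γ (NSub.id Δ) (fun _ X => X); rwa [hid, hid] at this
  | pabs T => have := (h Δ Γ (NSub.id Δ) (fun _ X => X)).1; rwa [hid, hid] at this
  | nabs T => have := (h Δ Γ (NSub.id Δ) (fun _ X => X)).1; rwa [hid, hid] at this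

theorem LR.papp {T : Ty S} {P Q : Tm ob Δ Γ (Ty.pabs T)} {A A' : Tm ob Δ Γ T}
    (h : LR B _ P Q) (hA : LR B T A A') : B (Tm.papp P A) (Tm.papp Q A') := by
  have hid : ∀ R : Tm ob Δ Γ (Ty.pabs T),
      R.sub (NSub.id Δ) (PSub.ofRen ob Δ fun _ X => X) = R := fun R => Tm.sub_id R
  have := (h Δ Γ (NSub.id Δ) (fun _ X => X)).2 A A' hA
  rwa [hid, hid] at this

theorem LR.napp {s : S} {P Q : Tm ob Δ Γ (Ty.nabs s)} (h : LR B _ P Q) (n : Nm Δ s) :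
    B (Tm.napp P n) (Tm.napp Q n) := by
  have hid : ∀ R : Tm ob Δ Γ (Ty.nabs s),
      R.sub (NSub.id Δ) (PSub.ofRen ob Δ fun _ X => X) = R := fun R => Tm.sub_id R
  have := (h Δ Γ (NSub.id Δ) (fun _ X => X)).2 n
  rwa [hid, hid] at this

theorem LR.symm (hB : ∀ ⦃Δ Γ T⦄ ⦃P Q : Tm ob Δ Γ T⦄, B P Q → B Q P) {T : Ty S}
    {P Q : Tm ob Δ Γ T} (h : LR B T P Q) : LR B T Q P := by
  induction T generalizing Δ Γ with
  | proc => exact fun Δ' Γ' ρ r => hB (h Δ' Γ' ρ r)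
  | pabs T ih =>
    exact fun Δ' Γ' ρ r =>
      ⟨hB (h Δ' Γ' ρ r).1, fun A A' hA => hB ((h Δ' Γ' ρ r).2 A' A (ih hA))⟩
  | nabs s =>
    exact fun Δ' Γ' ρ r => ⟨hB (h Δ' Γ' ρ r).1, fun n => hB ((h Δ' Γ' ρ r).2 n)⟩

theorem LR.trans (hB : ∀ ⦃Δ Γ T⦄ ⦃P Q : Tm ob Δ Γ T⦄, B P Q → B Q P)
    (hB' : ∀ ⦃Δ Γ T⦄ ⦃P Q R : Tm ob Δ Γ T⦄, B P Q → B Q R → B P R) {T : Ty S}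
    {P Q R : Tm ob Δ Γ T} (h : LR B T P Q) (h' : LR B T Q R) : LR B T P R := by
  induction T generalizing Δ Γ with
  | proc => exact fun Δ' Γ' ρ r => hB' (h Δ' Γ' ρ r) (h' Δ' Γ' ρ r)
  | pabs T ih =>
    exact fun Δ' Γ' ρ r =>
      ⟨hB' (h Δ' Γ' ρ r).1 (h' Δ' Γ' ρ r).1, fun A A' hA =>
        hB' ((h Δ' Γ' ρ r).2 A A' hA) ((h' Δ' Γ' ρ r).2 A' A' (ih (hA.symm hB) hA))⟩
  | nabs s =>
    exact fun Δ' Γ' ρ r => ⟨hB' (h Δ' Γ' ρ r).1 (h' Δ' Γ' ρ r).1,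
      fun n => hB' ((h Δ' Γ' ρ r).2 n) ((h' Δ' Γ' ρ r).2 n)⟩

/-- Logically related substitutions. -/
def PSub.Rel (B : TRel ob) (σ σ' : PSub ob Δ Γ Γ') : Prop := ∀ T X, LR B T (σ T X) (σ' T X)

theorem PSub.Rel.mono {Δ'' : List S} {Γ'' : List (Ty S)} {σ σ' : PSub ob Δ Γ Γ'}
    (h : PSub.Rel B σ σ') (ρ : NSub Δ Δ'') (r : Ren Γ' Γ'') :
    PSub.Rel B (σ.andThen ρ (PSub.ofRen ob Δ'' r)) (σ'.andThen ρ (PSub.ofRen ob Δ'' r)) :=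
  fun T X => (h T X).mono ρ r

theorem PSub.Rel.cons {T : Ty S} {σ σ' : PSub ob Δ Γ Γ'} (h : PSub.Rel B σ σ')
    {A A' : Tm ob Δ Γ' T} (hA : LR B T A A') : PSub.Rel B (PSub.cons A σ) (PSub.cons A' σ') := by
  rintro _ (_ | X)
  · exact hA
  · exact h _ X

theorem PSub.Rel.lift
    (hv : ∀ ⦃Δ : List S⦄ ⦃Γ : List (Ty S)⦄ ⦃T : Ty S⦄ (X : Var Γ T),
      LR B T (Tm.var X : Tm ob Δ Γ T) (Tm.var X)) {σ σ' : PSub ob Δ Γ Γ'}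
    (h : PSub.Rel B σ σ') (T : Ty S) : PSub.Rel B (σ.lift T) (σ'.lift T) := by
  rintro _ (_ | X)
  · exact hv _
  · simp only [PSub.lift, Tm.wk, Tm.ren_eq_sub]
    exact (h _ X).mono _ _

theorem PSub.Rel.nlift {σ σ' : PSub ob Δ Γ Γ'} (h : PSub.Rel B σ σ') (s : S) :
    PSub.Rel B (σ.nlift s) (σ'.nlift s) := by
  intro T X
  simp only [PSub.nlift, Tm.nsub_eq_sub]
  exact (h _ X).mono (NSub.wk s) (fun _ X => X)

/-- Terms whose instances under logically related substitutions are logically related. -/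
def SubRel (B : TRel ob) {T : Ty S} (P Q : Tm ob Δ Γ T) : Prop :=
  ∀ ⦃Δ' : List S⦄ ⦃Γ' : List (Ty S)⦄ (ρ : NSub Δ Δ') (σ σ' : PSub ob Δ' Γ Γ'),
    PSub.Rel B σ σ' → LR B T (P.sub ρ σ) (Q.sub ρ σ')

/-- The base relation suffices: a further renaming of the instances is absorbed into the
substitutions. -/
theorem SubRel.of_proc {P Q : Tm ob Δ Γ Ty.proc}
    (h : ∀ ⦃Δ' : List S⦄ ⦃Γ' : List (Ty S)⦄ (ρ : NSub Δ Δ') (σ σ' : PSub ob Δ' Γ Γ'),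
      PSub.Rel B σ σ' → B (P.sub ρ σ) (Q.sub ρ σ')) : SubRel B P Q := by
  intro Δ' Γ' ρ σ σ' hσ Δ'' Γ'' ρ' r
  simp only [Tm.sub_sub]
  exact h _ _ _ (hσ.mono ρ' r)

theorem SubRel.of_pabs {T : Ty S} {P Q : Tm ob Δ Γ (Ty.pabs T)}
    (h : ∀ ⦃Δ' : List S⦄ ⦃Γ' : List (Ty S)⦄ (ρ : NSub Δ Δ') (σ σ' : PSub ob Δ' Γ Γ'),
      PSub.Rel B σ σ' → B (P.sub ρ σ) (Q.sub ρ σ') ∧ ∀ A A' : Tm ob Δ' Γ' T, LR B T A A' →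
        B (Tm.papp (P.sub ρ σ) A) (Tm.papp (Q.sub ρ σ') A')) : SubRel B P Q := by
  intro Δ' Γ' ρ σ σ' hσ Δ'' Γ'' ρ' r
  simp only [Tm.sub_sub]
  exact h _ _ _ (hσ.mono ρ' r)

theorem SubRel.of_nabs {s : S} {P Q : Tm ob Δ Γ (Ty.nabs s)}
    (h : ∀ ⦃Δ' : List S⦄ ⦃Γ' : List (Ty S)⦄ (ρ : NSub Δ Δ') (σ σ' : PSub ob Δ' Γ Γ'),
      PSub.Rel B σ σ' → B (P.sub ρ σ) (Q.sub ρ σ') ∧ ∀ n : Nm Δ' s,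
        B (Tm.napp (P.sub ρ σ) n) (Tm.napp (Q.sub ρ σ') n)) : SubRel B P Q := by
  intro Δ' Γ' ρ σ σ' hσ Δ'' Γ'' ρ' r
  simp only [Tm.sub_sub]
  exact h _ _ _ (hσ.mono ρ' r)

end LR

/-! ### Normalization -/

/-- Structural congruence together with normalization and equality of prime components. -/
def NormSC : TRel ob := fun _ _ T P Q =>
  SC P Q ∧ (∃ n, Sz n P) ∧ (T = Ty.proc → ∃ a, Ev P a ∧ Ev Q a)

section NormSC

variable {Δ Δ' : List S} {Γ Γ' : List (Ty S)}

theorem NormSC.symm ⦃Δ : List S⦄ ⦃Γ : List (Ty S)⦄ ⦃T : Ty S⦄ ⦃P Q : Tm ob Δ Γ T⦄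
    (h : NormSC P Q) : NormSC Q P := by
  obtain ⟨h1, ⟨n, hn⟩, h3⟩ := h
  exact ⟨h1.symm, ⟨n, hn.struct h1⟩, fun hT => (h3 hT).imp fun a h => h.symm⟩

/-- Determinism of evaluation identifies the two multisets obtained for `Q`. -/
theorem NormSC.trans ⦃Δ : List S⦄ ⦃Γ : List (Ty S)⦄ ⦃T : Ty S⦄ ⦃P Q R : Tm ob Δ Γ T⦄
    (h : NormSC P Q) (h' : NormSC Q R) : NormSC P R := by
  refine ⟨h.1.trans h'.1, h.2.1, fun hT => ?_⟩
  obtain ⟨a, ha, ha'⟩ := h.2.2 hT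
  obtain ⟨b, hb, hb'⟩ := h'.2.2 hT
  exact ⟨a, ha, ha'.det hb ▸ hb'⟩

/-- Closure under head expansion, the property that makes abstractions logically related. -/
theorem NormSC.pbeta_left {T : Ty S} {P : Tm ob Δ (T :: Γ) Ty.proc} {A : Tm ob Δ Γ T}
    {Q : Tm ob Δ Γ Ty.proc} (h : NormSC (P.inst A) Q) : NormSC (Tm.papp (Tm.pabs P) A) Q := by
  obtain ⟨h1, ⟨n, hn⟩, h3⟩ := h
  exact ⟨(SC.pbeta P A).trans h1, ⟨n, hn.struct (SC.pbeta P A).symm⟩,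
    fun hT => (h3 hT).imp fun a h => ⟨.pbeta h.1, h.2⟩⟩

theorem NormSC.nbeta_left {s : S} {P : Tm ob (s :: Δ) Γ Ty.proc} {n : Nm Δ s}
    {Q : Tm ob Δ Γ Ty.proc} (h : NormSC (P.ninst n) Q) : NormSC (Tm.napp (Tm.nabs P) n) Q := by
  obtain ⟨h1, ⟨k, hk⟩, h3⟩ := h
  exact ⟨(SC.nbeta P n).trans h1, ⟨k, hk.struct (SC.nbeta P n).symm⟩,
    fun hT => (h3 hT).imp fun a h => ⟨.nbeta h.1, h.2⟩⟩

/-- An applied variable is already a component, with its argument modulo congruence, so only the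
base relation between the arguments is used. -/
theorem NormSC.lr_var ⦃Δ : List S⦄ ⦃Γ : List (Ty S)⦄ ⦃T : Ty S⦄ (X : Var Γ T) :
    LR NormSC T (Tm.var X : Tm ob Δ Γ T) (Tm.var X) := by
  cases T with
  | proc =>
    exact fun _ _ ρ r => ⟨SC.refl _, Sz.exists_var _, fun _ => ⟨_, .var _, .var _⟩⟩
  | pabs T =>
    refine fun _ _ ρ r => ⟨⟨SC.refl _, Sz.exists_var _, nofun⟩, fun A A' hA => ?_⟩
    obtain ⟨h1, ⟨n, hn⟩, -⟩ := hA.base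
    refine ⟨SC.papp (SC.refl _) h1, ⟨_, .papp _ hn⟩, fun _ => ⟨_, .papp _ _, ?_⟩⟩
    rw [Tm.cl_eq.2 h1]
    exact .papp _ _
  | nabs s =>
    exact fun _ _ ρ r => ⟨⟨SC.refl _, Sz.exists_var _, nofun⟩, fun n =>
      ⟨SC.refl _, ⟨_, .napp _ _⟩, fun _ => ⟨_, .napp _ _, .napp _ _⟩⟩⟩

theorem NormSC.subRel_nil : SubRel NormSC (Tm.nil : Tm ob Δ Γ Ty.proc) Tm.nil :=
  .of_proc fun _ _ _ _ _ _ => ⟨SC.refl _, ⟨_, .nil⟩, fun _ => ⟨_, .nil, .nil⟩⟩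

theorem NormSC.subRel_inp {s : S} (m : Nm Δ s) {P P' : Tm ob Δ (ob s :: Γ) Ty.proc}
    (h : SubRel NormSC P P') : SubRel NormSC (Tm.inp m P) (Tm.inp m P') := by
  refine .of_proc fun Δ' Γ' ρ σ σ' hσ => ?_
  obtain ⟨h1, ⟨n, hn⟩, -⟩ := (h ρ _ _ (hσ.lift NormSC.lr_var (ob s))).base
  refine ⟨SC.inp _ h1, ⟨_, .inp _ hn⟩, fun _ => ⟨_, .inp _ _, ?_⟩⟩
  change Ev _ {Pr.inp _ (P.sub ρ (σ.lift (ob s))).cl}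
  rw [Tm.cl_eq.2 h1]
  exact .inp _ _

theorem NormSC.subRel_out {s : S} (m : Nm Δ s) {A A' : Tm ob Δ Γ (ob s)}
    (h : SubRel NormSC A A') : SubRel NormSC (Tm.out m A) (Tm.out m A') := by
  refine .of_proc fun Δ' Γ' ρ σ σ' hσ => ?_
  obtain ⟨h1, ⟨n, hn⟩, -⟩ := (h ρ _ _ hσ).base
  refine ⟨SC.out _ h1, ⟨_, .out _ hn⟩, fun _ => ⟨_, .out _ _, ?_⟩⟩
  change Ev _ {Pr.out _ (A.sub ρ σ).cl}
  rw [Tm.cl_eq.2 h1]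
  exact .out _ _

theorem NormSC.subRel_par {P P' Q Q' : Tm ob Δ Γ Ty.proc}
    (h : SubRel NormSC P P') (h' : SubRel NormSC Q Q') :
    SubRel NormSC (Tm.par P Q) (Tm.par P' Q') := by
  refine .of_proc fun Δ' Γ' ρ σ σ' hσ => ?_
  obtain ⟨h1, ⟨n, hn⟩, h3⟩ := (h ρ _ _ hσ).base
  obtain ⟨h1', ⟨n', hn'⟩, h3'⟩ := (h' ρ _ _ hσ).base
  obtain ⟨a, ha, ha'⟩ := h3 rfl
  obtain ⟨b, hb, hb'⟩ := h3' rfl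
  exact ⟨SC.par h1 h1', ⟨_, .par hn hn'⟩, fun _ => ⟨_, .par ha hb, .par ha' hb'⟩⟩

theorem NormSC.subRel_pabs {T : Ty S} {P P' : Tm ob Δ (T :: Γ) Ty.proc}
    (h : SubRel NormSC P P') : SubRel NormSC (Tm.pabs P) (Tm.pabs P') := by
  refine .of_pabs fun Δ' Γ' ρ σ σ' hσ => ?_
  obtain ⟨h1, ⟨n, hn⟩, -⟩ := (h ρ _ _ (hσ.lift NormSC.lr_var T)).base
  refine ⟨⟨SC.pabs h1, ⟨_, .pabs hn⟩, nofun⟩, fun A A' hA => ?_⟩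
  refine NormSC.pbeta_left (NormSC.symm (NormSC.pbeta_left (NormSC.symm ?_)))
  change NormSC ((P.sub ρ (σ.lift T)).inst A) ((P'.sub ρ (σ'.lift T)).inst A')
  rw [Tm.inst_sub_lift, Tm.inst_sub_lift]
  exact (h ρ _ _ (hσ.cons hA)).base

theorem NormSC.subRel_papp {T : Ty S} {P P' : Tm ob Δ Γ (Ty.pabs T)} {A A' : Tm ob Δ Γ T}
    (h : SubRel NormSC P P') (h' : SubRel NormSC A A') :
    SubRel NormSC (Tm.papp P A) (Tm.papp P' A') :=
  .of_proc fun _ _ ρ _ _ hσ => (h ρ _ _ hσ).papp (h' ρ _ _ hσ)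

theorem NormSC.subRel_nabs {s : S} {P P' : Tm ob (s :: Δ) Γ Ty.proc}
    (h : SubRel NormSC P P') : SubRel NormSC (Tm.nabs P) (Tm.nabs P') := by
  refine .of_nabs fun Δ' Γ' ρ σ σ' hσ => ?_
  obtain ⟨h1, ⟨n, hn⟩, -⟩ := (h (ρ.lift s) _ _ (hσ.nlift s)).base
  refine ⟨⟨SC.nabs h1, ⟨_, .nabs hn⟩, nofun⟩, fun n => ?_⟩
  refine NormSC.nbeta_left (NormSC.symm (NormSC.nbeta_left (NormSC.symm ?_)))
  change NormSC ((P.sub (ρ.lift s) (σ.nlift s)).ninst n)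
    ((P'.sub (ρ.lift s) (σ'.nlift s)).ninst n)
  rw [Tm.ninst_sub_lift, Tm.ninst_sub_lift]
  exact (h _ _ _ hσ).base

theorem NormSC.subRel_napp {s : S} {P P' : Tm ob Δ Γ (Ty.nabs s)} (n : Nm Δ s)
    (h : SubRel NormSC P P') : SubRel NormSC (Tm.napp P n) (Tm.napp P' n) :=
  .of_proc fun _ _ ρ _ _ hσ => (h ρ _ _ hσ).napp _

/-- The fundamental lemma of the logical relation; it contains normalization. -/
theorem NormSC.subRel_refl {T : Ty S} (P : Tm ob Δ Γ T) : SubRel NormSC P P := by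
  induction P with
  | nil => exact subRel_nil
  | var X => exact fun _ _ _ _ _ hσ => hσ _ X
  | inp m _ ih => exact subRel_inp m ih
  | out m _ ih => exact subRel_out m ih
  | par _ _ ih ih' => exact subRel_par ih ih'
  | pabs _ ih => exact subRel_pabs ih
  | papp _ _ ih ih' => exact subRel_papp ih ih'
  | nabs _ ih => exact subRel_nabs ih
  | napp _ n ih => exact subRel_napp n ih

/-- A law between processes that holds for evaluation gives logically related terms. -/
theorem NormSC.subRel_of_law {P Q : Tm ob Δ Γ Ty.proc}
    (h : ∀ ⦃Δ' : List S⦄ ⦃Γ' : List (Ty S)⦄ (ρ : NSub Δ Δ') (σ : PSub ob Δ' Γ Γ'),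
      SC (P.sub ρ σ) (Q.sub ρ σ) ∧ ∀ a, Ev (P.sub ρ σ) a → Ev (Q.sub ρ σ) a) :
    SubRel NormSC P Q := by
  refine .of_proc fun Δ' Γ' ρ σ σ' hσ => ?_
  have h1 := (subRel_refl P ρ _ _ hσ).base
  refine h1.trans ⟨(h ρ σ').1, h1.symm.2.1, fun hT => ?_⟩
  obtain ⟨a, -, ha⟩ := h1.2.2 hT
  exact ⟨a, ha, (h ρ σ').2 a ha⟩

/-- The fundamental lemma for derivations of congruence: the congruence rules repeat the cases for
terms, and each axiom compares one evaluation with another. It yields both the invariance of the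
multiset of components and the closure of congruence under substitution. -/
theorem NormSC.subRel_of_sc {T : Ty S} {P Q : Tm ob Δ Γ T} (h : SC P Q) :
    SubRel NormSC P Q := by
  induction h with
  | refl P => exact subRel_refl P
  | symm _ ih => exact fun _ _ ρ _ _ hσ =>
      (ih ρ _ _ fun T X => (hσ T X).symm NormSC.symm).symm NormSC.symm
  -- The first half is used with `σ` on both sides, `σ` being related to itself by symmetry and
  -- transitivity.
  | trans _ _ ih ih' => exact fun _ _ ρ _ _ hσ =>
      (ih ρ _ _ fun T X => (hσ T X).trans NormSC.symm NormSC.trans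
        ((hσ T X).symm NormSC.symm)).trans NormSC.symm NormSC.trans (ih' ρ _ _ hσ)
  | inp m _ ih => exact subRel_inp m ih
  | out m _ ih => exact subRel_out m ih
  | par _ _ ih ih' => exact subRel_par ih ih'
  | pabs _ ih => exact subRel_pabs ih
  | papp _ _ ih ih' => exact subRel_papp ih ih'
  | nabs _ ih => exact subRel_nabs ih
  | napp n _ ih => exact subRel_napp n ih
  | par_assoc P Q R =>
    refine subRel_of_law fun _ _ ρ σ => ⟨SC.par_assoc _ _ _, fun a ha => ?_⟩
    cases ha with | par h h3 => cases h with | par h1 h2 =>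
    rw [add_assoc]
    exact .par h1 (.par h2 h3)
  | par_comm P Q =>
    refine subRel_of_law fun _ _ ρ σ => ⟨SC.par_comm _ _, fun a ha => ?_⟩
    cases ha with | par h1 h2 =>
    rw [add_comm]
    exact .par h2 h1
  | par_nil P =>
    refine subRel_of_law fun _ _ ρ σ => ⟨SC.par_nil _, fun a ha => ?_⟩
    cases ha with | par h1 h2 =>
    cases h2
    rwa [add_zero]
  | @pbeta Δ Γ T P Q =>
    refine subRel_of_law fun _ _ ρ σ => ?_
    rw [Tm.sub_inst, ← Tm.inst_sub_lift]
    refine ⟨SC.pbeta _ _, fun a ha => ?_⟩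
    cases ha with | pbeta h => exact h
  | @nbeta Δ Γ s P n =>
    refine subRel_of_law fun _ _ ρ σ => ?_
    rw [Tm.sub_ninst, ← Tm.ninst_sub_lift]
    refine ⟨SC.nbeta _ _, fun a ha => ?_⟩
    cases ha with | nbeta h => exact h

theorem NormSC.rel_refl (σ : PSub ob Δ Γ Γ') : PSub.Rel NormSC σ σ := fun T X => by
  have := subRel_refl (σ T X) (NSub.id Δ) (PSub.id ob Δ Γ') (PSub.id ob Δ Γ')
    fun _ X => NormSC.lr_var X
  rwa [Tm.sub_id] at this

theorem NormSC.of_sc {T : Ty S} {P Q : Tm ob Δ Γ T} (h : SC P Q) : NormSC P Q := by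
  have := (subRel_of_sc h (NSub.id Δ) _ _ (rel_refl (PSub.id ob Δ Γ))).base
  rwa [Tm.sub_id, Tm.sub_id] at this

theorem SC.sub {T : Ty S} {P Q : Tm ob Δ Γ T} (h : SC P Q) (ρ : NSub Δ Δ')
    (σ : PSub ob Δ' Γ Γ') : SC (P.sub ρ σ) (Q.sub ρ σ) :=
  (NormSC.subRel_of_sc h ρ _ _ (NormSC.rel_refl σ)).base.1

theorem Sz.exists_size {T : Ty S} (P : Tm ob Δ Γ T) : ∃ n, Sz n P :=
  (NormSC.of_sc (SC.refl P)).2.1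

end NormSC

/-! ### The multiset of prime components -/

open Classical in
/-- The prime components of a process (none for abstractions). -/
noncomputable def Tm.comps {Δ : List S} {Γ : List (Ty S)} {T : Ty S} (P : Tm ob Δ Γ T) :
    Multiset (Pr ob Δ Γ) :=
  if h : ∃ a, Ev P a then h.choose else 0

section comps

variable {Δ Δ' : List S} {Γ Γ' : List (Ty S)}

theorem Ev.comps_eq {T : Ty S} {P : Tm ob Δ Γ T} {a : Multiset (Pr ob Δ Γ)} (h : Ev P a) :
    P.comps = a := by
  have h' : ∃ a, Ev P a := ⟨a, h⟩
  rw [Tm.comps, dif_pos h']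
  exact h'.choose_spec.det h

theorem Tm.ev_comps (P : Tm ob Δ Γ Ty.proc) : Ev P P.comps := by
  obtain ⟨a, ha, -⟩ := (NormSC.of_sc (SC.refl P)).2.2 rfl
  rwa [ha.comps_eq]

theorem Tm.comps_of_ne_proc {T : Ty S} (hT : T ≠ Ty.proc) (P : Tm ob Δ Γ T) : P.comps = 0 := by
  rw [Tm.comps, dif_neg]
  rintro ⟨a, ha⟩
  cases ha <;> exact hT rfl

theorem SC.comps_eq {T : Ty S} {P Q : Tm ob Δ Γ T} (h : SC P Q) : P.comps = Q.comps := by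
  by_cases hT : T = Ty.proc
  · obtain ⟨a, ha, ha'⟩ := (NormSC.of_sc h).2.2 hT
    rw [ha.comps_eq, ha'.comps_eq]
  · rw [Tm.comps_of_ne_proc hT, Tm.comps_of_ne_proc hT]

@[simp] theorem Tm.comps_nil : (Tm.nil : Tm ob Δ Γ Ty.proc).comps = 0 := Ev.nil.comps_eq

@[simp] theorem Tm.comps_par (P Q : Tm ob Δ Γ Ty.proc) :
    (Tm.par P Q).comps = P.comps + Q.comps :=
  (Ev.par P.ev_comps Q.ev_comps).comps_eq

@[simp] theorem Tm.comps_out {s : S} (m : Nm Δ s) (A : Tm ob Δ Γ (ob s)) :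
    (Tm.out m A).comps = {Pr.out m A.cl} := (Ev.out m A).comps_eq

@[simp] theorem Tm.comps_inp {s : S} (m : Nm Δ s) (P : Tm ob Δ (ob s :: Γ) Ty.proc) :
    (Tm.inp m P).comps = {Pr.inp m P.cl} := (Ev.inp m P).comps_eq

@[simp] theorem Tm.comps_var (X : Var Γ Ty.proc) :
    (Tm.var X : Tm ob Δ Γ Ty.proc).comps = {Pr.var X} := (Ev.var X).comps_eq

@[simp] theorem Tm.comps_papp {T : Ty S} (X : Var Γ (Ty.pabs T)) (A : Tm ob Δ Γ T) :
    (Tm.papp (Tm.var X) A).comps = {Pr.papp X A.cl} := (Ev.papp X A).comps_eq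

@[simp] theorem Tm.comps_napp {s : S} (X : Var Γ (Ty.nabs s)) (d : Nm Δ s) :
    (Tm.napp (Tm.var X) d : Tm ob Δ Γ Ty.proc).comps = {Pr.napp X d} := (Ev.napp X d).comps_eq

theorem Pr.exists_term (p : Pr ob Δ Γ) : ∃ P : Tm ob Δ Γ Ty.proc, P.comps = {p} := by
  cases p with
  | out m a => obtain ⟨A, rfl⟩ := a.exists_rep'; exact ⟨_, Tm.comps_out m A⟩
  | inp m a => obtain ⟨A, rfl⟩ := a.exists_rep'; exact ⟨_, Tm.comps_inp m A⟩
  | var X => exact ⟨_, Tm.comps_var X⟩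
  | papp X a => obtain ⟨A, rfl⟩ := a.exists_rep'; exact ⟨_, Tm.comps_papp X A⟩
  | napp X d => exact ⟨_, Tm.comps_napp X d⟩

theorem Tm.exists_comps_eq (a : Multiset (Pr ob Δ Γ)) : ∃ P : Tm ob Δ Γ Ty.proc, P.comps = a := by
  induction a using Multiset.induction with
  | empty => exact ⟨_, Tm.comps_nil⟩
  | cons p a ih =>
    obtain ⟨P, rfl⟩ := ih
    obtain ⟨Q, hQ⟩ := p.exists_term
    exact ⟨Tm.par Q P, by rw [Tm.comps_par, hQ, Multiset.singleton_add]⟩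

theorem SC.par_nil_left (P : Tm ob Δ Γ Ty.proc) : SC (Tm.par Tm.nil P) P :=
  (SC.par_comm _ _).trans (SC.par_nil P)

/-! ### The commutative monoid of processes modulo congruence -/

instance clZero : Zero (Cl ob Δ Γ Ty.proc) := ⟨Tm.nil.cl⟩

instance clAdd : Add (Cl ob Δ Γ Ty.proc) :=
  ⟨Quotient.map₂ Tm.par fun _ _ h _ _ h' => SC.par h h'⟩

instance clAddCommMonoid : AddCommMonoid (Cl ob Δ Γ Ty.proc) where
  add_assoc := by
    rintro ⟨P⟩ ⟨Q⟩ ⟨R⟩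
    exact Quotient.sound (SC.par_assoc P Q R)
  zero_add := by
    rintro ⟨P⟩
    exact Quotient.sound (SC.par_nil_left P)
  add_zero := by
    rintro ⟨P⟩
    exact Quotient.sound (SC.par_nil P)
  add_comm := by
    rintro ⟨P⟩ ⟨Q⟩
    exact Quotient.sound (SC.par_comm P Q)
  nsmul := nsmulRec

/-- A prime component as a process, up to structural congruence. -/
def Pr.cl : Pr ob Δ Γ → Cl ob Δ Γ Ty.proc
  | .out m a => Quotient.map (Tm.out m) (fun _ _ h => SC.out m h) a
  | .inp m a => Quotient.map (Tm.inp m) (fun _ _ h => SC.inp m h) a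
  | .var X => (Tm.var X).cl
  | .papp X a => Quotient.map (Tm.papp (Tm.var X)) (fun _ _ h => SC.papp (SC.refl _) h) a
  | .napp X d => (Tm.napp (Tm.var X) d).cl

/-- Evaluation only uses congruences, so a process is the sum of its components. The cast is there
because `Ev` is indexed by all types. -/
theorem Ev.sum_eq {T : Ty S} {P : Tm ob Δ Γ T} {a : Multiset (Pr ob Δ Γ)} (h : Ev P a)
    (hT : T = Ty.proc) : (a.map Pr.cl).sum = (hT ▸ P).cl := by
  induction h with
  | nil => rfl
  | par _ _ ih ih' =>
    rw [Multiset.map_add, Multiset.sum_add, ih rfl, ih' rfl]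
    rfl
  | pbeta _ ih => exact (ih rfl).trans (Tm.cl_eq.2 (SC.pbeta _ _).symm)
  | nbeta _ ih => exact (ih rfl).trans (Tm.cl_eq.2 (SC.nbeta _ _).symm)
  | _ =>
    rw [Multiset.map_singleton, Multiset.sum_singleton]
    rfl

/-- The components are a complete invariant of processes modulo congruence, which lets multiset
cancellation replace arguments on derivations. -/
theorem Tm.comps_eq_iff {P Q : Tm ob Δ Γ Ty.proc} : P.comps = Q.comps ↔ SC P Q := by
  refine ⟨fun h => Tm.cl_eq.1 ?_, SC.comps_eq⟩
  have hP := P.ev_comps.sum_eq rfl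
  have hQ := Q.ev_comps.sum_eq rfl
  rw [← h, hP] at hQ
  exact hQ

theorem Tm.exists_comps_eq_cons {P : Tm ob Δ Γ Ty.proc} {p : Pr ob Δ Γ} (h : p ∈ P.comps) :
    ∃ P' : Tm ob Δ Γ Ty.proc, P.comps = p ::ₘ P'.comps := by
  obtain ⟨a, ha⟩ := Multiset.exists_cons_of_mem h
  obtain ⟨P', rfl⟩ := Tm.exists_comps_eq a
  exact ⟨P', ha⟩

/-- A component of a parallel composition is a component of one of its sides. -/
theorem Tm.comps_add_eq_cons {P Q R : Tm ob Δ Γ Ty.proc} {p : Pr ob Δ Γ}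
    (h : P.comps + Q.comps = p ::ₘ R.comps) :
    (∃ P', P.comps = p ::ₘ P'.comps ∧ SC R (Tm.par P' Q)) ∨
    (∃ Q', Q.comps = p ::ₘ Q'.comps ∧ SC R (Tm.par P Q')) := by
  have hp : p ∈ P.comps + Q.comps := by rw [h]; exact Multiset.mem_cons_self _ _
  rcases Multiset.mem_add.1 hp with hp | hp
  · obtain ⟨P', hP'⟩ := Tm.exists_comps_eq_cons hp
    refine .inl ⟨P', hP', Tm.comps_eq_iff.1 ?_⟩
    rw [hP', Multiset.cons_add, Multiset.cons_inj_right] at h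
    rw [Tm.comps_par, h]
  · obtain ⟨Q', hQ'⟩ := Tm.exists_comps_eq_cons hp
    refine .inr ⟨Q', hQ', Tm.comps_eq_iff.1 ?_⟩
    rw [hQ', Multiset.add_cons, Multiset.cons_inj_right] at h
    rw [Tm.comps_par, h]

theorem Tm.comps_singleton_eq_cons {R : Tm ob Δ Γ Ty.proc} {p q : Pr ob Δ Γ}
    (h : {q} = p ::ₘ R.comps) : p = q ∧ SC R Tm.nil := by
  have := (Multiset.singleton_eq_cons_iff _ ).1 h
  exact ⟨this.1.symm, Tm.comps_eq_iff.1 (by rw [this.2, Tm.comps_nil])⟩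

theorem Tm.comps_eq_cons_iff {P P' : Tm ob Δ Γ Ty.proc} {p : Pr ob Δ Γ} {R : Tm ob Δ Γ Ty.proc}
    (hR : R.comps = {p}) : P.comps = p ::ₘ P'.comps ↔ SC P (Tm.par R P') := by
  rw [← Tm.comps_eq_iff, Tm.comps_par, hR, Multiset.singleton_add]

end comps

/-! ### Substitution on components -/

def Cl.sub {Δ Δ' : List S} {Γ Γ' : List (Ty S)} {T : Ty S} (ρ : NSub Δ Δ')
    (σ : PSub ob Δ' Γ Γ') : Cl ob Δ Γ T → Cl ob Δ' Γ' T :=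
  Quotient.map (Tm.sub ρ σ) fun _ _ h => SC.sub h ρ σ

/-- The components that a component has after a substitution. -/
noncomputable def Pr.sub {Δ Δ' : List S} {Γ Γ' : List (Ty S)} (ρ : NSub Δ Δ')
    (σ : PSub ob Δ' Γ Γ') : Pr ob Δ Γ → Multiset (Pr ob Δ' Γ')
  | .out m a => {.out (m.nsub ρ) (a.sub ρ σ)}
  | .inp m a => {.inp (m.nsub ρ) (a.sub ρ (σ.lift _))}
  | .var X => (σ _ X).comps
  | .papp X a => (Tm.papp (σ _ X) (a.sub ρ σ).out).comps
  | .napp X d => (Tm.napp (σ _ X) (d.nsub ρ)).comps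

section sub

variable {Δ Δ' : List S} {Γ Γ' : List (Ty S)}

/-- The representative chosen in `Pr.sub` does not matter. -/
theorem Pr.sub_papp {T : Ty S} (ρ : NSub Δ Δ') (σ : PSub ob Δ' Γ Γ') (X : Var Γ (Ty.pabs T))
    (A : Tm ob Δ Γ T) : Pr.sub ρ σ (.papp X A.cl) = (Tm.papp (σ _ X) (A.sub ρ σ)).comps :=
  SC.comps_eq (SC.papp (SC.refl _) (Tm.cl_eq.1 (Quotient.out_eq (A.sub ρ σ).cl)))

theorem Ev.comps_sub {T : Ty S} {P : Tm ob Δ Γ T} {a : Multiset (Pr ob Δ Γ)} (h : Ev P a)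
    (ρ : NSub Δ Δ') (σ : PSub ob Δ' Γ Γ') : (P.sub ρ σ).comps = a.bind (Pr.sub ρ σ) := by
  induction h with
  | nil => exact Tm.comps_nil
  | par _ _ ih ih' =>
    rw [Multiset.add_bind, ← ih, ← ih']
    exact Tm.comps_par _ _
  | out m A => rw [Multiset.singleton_bind]; exact Tm.comps_out _ _
  | inp m A => rw [Multiset.singleton_bind]; exact Tm.comps_inp _ _
  | var X => rw [Multiset.singleton_bind]; rfl
  | papp X A => rw [Multiset.singleton_bind, Pr.sub_papp]; rfl
  | napp X d => rw [Multiset.singleton_bind]; rfl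
  | pbeta _ ih => rw [← ih]; exact SC.comps_eq (SC.sub (SC.pbeta _ _) ρ σ)
  | nbeta _ ih => rw [← ih]; exact SC.comps_eq (SC.sub (SC.nbeta _ _) ρ σ)

theorem Tm.comps_sub (P : Tm ob Δ Γ Ty.proc) (ρ : NSub Δ Δ') (σ : PSub ob Δ' Γ Γ') :
    (P.sub ρ σ).comps = P.comps.bind (Pr.sub ρ σ) :=
  P.ev_comps.comps_sub ρ σ

theorem SC.wk {T U : Ty S} {P Q : Tm ob Δ Γ T} (h : SC P Q) : SC (P.wk U) (Q.wk U) := by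
  simp only [Tm.wk, Tm.ren_eq_sub]
  exact h.sub _ _

theorem SC.psub {T : Ty S} {P Q : Tm ob Δ Γ T} (h : SC P Q) (σ : PSub ob Δ Γ Γ') :
    SC (P.psub σ) (Q.psub σ) := by
  simp only [Tm.psub_eq_sub]
  exact h.sub _ _

theorem SC.inst {T U : Ty S} {P Q : Tm ob Δ (T :: Γ) U} (h : SC P Q) (A : Tm ob Δ Γ T) :
    SC (P.inst A) (Q.inst A) := h.psub _

end sub

/-! ### Transitions and components -/

section steps

variable {Δ : List S} {Γ : List (Ty S)}

/-- Outputs have no continuation, so the transition just removes a component. -/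
theorem OutStep.iff_comps {s : S} {m : Nm Δ s} {A : Tm ob Δ Γ (ob s)}
    {P P' : Tm ob Δ Γ Ty.proc} :
    OutStep m A P P' ↔ P.comps = Pr.out m A.cl ::ₘ P'.comps := by
  constructor
  · intro h
    induction h with
    | out => simp
    | parL Q _ ih => simp [ih]
    | parR Q _ ih => simp [ih]
    | struct h1 _ h2 ih => rw [h1.comps_eq, ih, h2.comps_eq]
  · intro h
    rw [Tm.comps_eq_cons_iff (Tm.comps_out m A)] at h
    exact .struct h (.parL P' .out) (SC.par_nil_left P')

theorem InStep.iff_comps {s : S} {m : Nm Δ s} {P : Tm ob Δ Γ Ty.proc}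
    {P' : Tm ob Δ (ob s :: Γ) Ty.proc} :
    InStep m P P' ↔ ∃ (P₁ : Tm ob Δ (ob s :: Γ) Ty.proc) (R : Tm ob Δ Γ Ty.proc),
      P.comps = Pr.inp m P₁.cl ::ₘ R.comps ∧ SC P' (Tm.par P₁ (R.wk (ob s))) := by
  constructor
  · intro h
    induction h with
    | inp P => exact ⟨P, Tm.nil, by simp, (SC.par_nil P).symm⟩
    | parL Q _ ih =>
      obtain ⟨P₁, R, h1, h2⟩ := ih
      exact ⟨P₁, Tm.par R Q, by simp [h1], (SC.par h2 (SC.refl _)).trans (SC.par_assoc _ _ _)⟩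
    | parR Q _ ih =>
      obtain ⟨P₁, R, h1, h2⟩ := ih
      exact ⟨P₁, Tm.par R Q, by simp [h1, add_comm],
        (SC.par_comm _ _).trans ((SC.par h2 (SC.refl _)).trans (SC.par_assoc _ _ _))⟩
    | struct h1 _ h2 ih =>
      obtain ⟨P₁, R, h3, h4⟩ := ih
      exact ⟨P₁, R, by rw [h1.comps_eq, h3], h2.symm.trans h4⟩
  · rintro ⟨P₁, R, h1, h2⟩
    rw [Tm.comps_eq_cons_iff (Tm.comps_inp m P₁)] at h1
    exact .struct h1 (.parL R (.inp P₁)) h2.symm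

/-- An internal transition is an output followed by an input of the emitted term. -/
theorem TauStep.exists_out_in {P P' : Tm ob Δ Γ Ty.proc} (h : TauStep P P') :
    ∃ (s : S) (m : Nm Δ s) (A : Tm ob Δ Γ (ob s)) (P₁ : Tm ob Δ Γ Ty.proc)
      (P₂ : Tm ob Δ (ob s :: Γ) Ty.proc),
      OutStep m A P P₁ ∧ InStep m P₁ P₂ ∧ SC P' (P₂.inst A) := by
  induction h with
  | @comL s m A P P' Q Q' h1 h2 =>
    refine ⟨s, m, A, _, _, .parL _ h1, .parR _ h2, ?_⟩
    change SC _ (Tm.par ((P'.wk _).inst A) (Q'.inst A))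
    rw [Tm.wk_inst]
    exact SC.refl _
  | @comR s m A P Q Q' P' h1 h2 =>
    refine ⟨s, m, A, _, _, .parR _ h2, .parL _ h1, ?_⟩
    change SC _ (Tm.par (P'.inst A) ((Q'.wk _).inst A))
    rw [Tm.wk_inst]
    exact SC.refl _
  | parL Q _ ih =>
    obtain ⟨s, m, A, P₁, P₂, h1, h2, h3⟩ := ih
    refine ⟨s, m, A, _, _, .parL _ h1, .parL _ h2, ?_⟩
    change SC _ (Tm.par (P₂.inst A) ((Q.wk _).inst A))
    rw [Tm.wk_inst]
    exact SC.par h3 (SC.refl _)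
  | parR Q _ ih =>
    obtain ⟨s, m, A, P₁, P₂, h1, h2, h3⟩ := ih
    refine ⟨s, m, A, _, _, .parR _ h1, .parR _ h2, ?_⟩
    change SC _ (Tm.par ((Q.wk _).inst A) (P₂.inst A))
    rw [Tm.wk_inst]
    exact SC.par (SC.refl _) h3
  | struct h1 _ h2 ih =>
    obtain ⟨s, m, A, P₁, P₂, h3, h4, h5⟩ := ih
    exact ⟨s, m, A, P₁, P₂, .struct h1 h3 (SC.refl _), h4, h2.symm.trans h5⟩

/-- The output removes its own component, so the input is made by what runs in parallel with it, and
the two can communicate. -/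
theorem TauStep.of_out_in {s : S} {m : Nm Δ s} {A : Tm ob Δ Γ (ob s)}
    {P P₁ : Tm ob Δ Γ Ty.proc} {P₂ : Tm ob Δ (ob s :: Γ) Ty.proc} (h : OutStep m A P P₁)
    (h' : InStep m P₁ P₂) : TauStep P (P₂.inst A) := by
  rw [OutStep.iff_comps, Tm.comps_eq_cons_iff (Tm.comps_out m A)] at h
  exact .struct h (.comL .out h') (SC.par_nil_left _)

end steps

/-! ### Sizes -/

/-- The size of a prime component. -/
def PrSz {Δ : List S} {Γ : List (Ty S)} (n : ℕ) : Pr ob Δ Γ → Prop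
  | .out _ a => ∃ A k, A.cl = a ∧ Sz k A ∧ n = k + 1
  | .inp _ a => ∃ A k, A.cl = a ∧ Sz k A ∧ n = k + 1
  | .var _ => n = 1
  | .papp _ a => ∃ A k, A.cl = a ∧ Sz k A ∧ n = k + 1
  | .napp _ _ => n = 1

section sizes

variable {Δ Δ' : List S} {Γ Γ' : List (Ty S)}

/-- Size is additive over components; the congruence rule of `Sz` is harmless because it does not
change the components. -/
theorem Sz.of_comps {T : Ty S} {n : ℕ} {P : Tm ob Δ Γ T} (h : Sz n P) {p : Pr ob Δ Γ}
    {P' : Tm ob Δ Γ Ty.proc} (hP : P.comps = p ::ₘ P'.comps) :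
    ∃ k l, PrSz k p ∧ Sz l P' ∧ k + l = n := by
  induction h with
  | struct h1 _ ih => exact ih (by rw [h1.comps_eq, hP])
  | nil =>
    rw [Tm.comps_nil] at hP
    exact absurd hP.symm (Multiset.cons_ne_zero)
  | par h1 h2 ih ih' =>
    rw [Tm.comps_par] at hP
    rcases Tm.comps_add_eq_cons hP with ⟨P₁, h3, h4⟩ | ⟨P₁, h3, h4⟩
    · obtain ⟨k, l, h5, h6, rfl⟩ := ih h3
      exact ⟨k, _, h5, (h6.par h2).struct h4.symm, by omega⟩
    · obtain ⟨k, l, h5, h6, rfl⟩ := ih' h3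
      exact ⟨k, _, h5, (h1.par h6).struct h4.symm, by omega⟩
  | inp m h _ =>
    rw [Tm.comps_inp] at hP
    obtain ⟨rfl, h'⟩ := Tm.comps_singleton_eq_cons hP
    exact ⟨_, 0, ⟨_, _, rfl, h, rfl⟩, Sz.nil.struct h'.symm, rfl⟩
  | out m h _ =>
    rw [Tm.comps_out] at hP
    obtain ⟨rfl, h'⟩ := Tm.comps_singleton_eq_cons hP
    exact ⟨_, 0, ⟨_, _, rfl, h, rfl⟩, Sz.nil.struct h'.symm, rfl⟩
  | var X =>
    rw [Tm.comps_var] at hP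
    obtain ⟨rfl, h'⟩ := Tm.comps_singleton_eq_cons hP
    exact ⟨1, 0, rfl, Sz.nil.struct h'.symm, rfl⟩
  | papp X h _ =>
    rw [Tm.comps_papp] at hP
    obtain ⟨rfl, h'⟩ := Tm.comps_singleton_eq_cons hP
    exact ⟨_, 0, ⟨_, _, rfl, h, rfl⟩, Sz.nil.struct h'.symm, rfl⟩
  | napp X d =>
    rw [Tm.comps_napp] at hP
    obtain ⟨rfl, h'⟩ := Tm.comps_singleton_eq_cons hP
    exact ⟨1, 0, rfl, Sz.nil.struct h'.symm, rfl⟩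
  | pabs _ _ =>
    rw [Tm.comps_of_ne_proc (by simp)] at hP
    exact absurd hP.symm (Multiset.cons_ne_zero)
  | nabs _ _ =>
    rw [Tm.comps_of_ne_proc (by simp)] at hP
    exact absurd hP.symm (Multiset.cons_ne_zero)

theorem PrSz.pos {n : ℕ} {p : Pr ob Δ Γ} (h : PrSz n p) : 0 < n := by
  cases p with
  | var X => simp only [PrSz] at h; omega
  | napp X d => simp only [PrSz] at h; omega
  | _ => obtain ⟨_, _, _, _, rfl⟩ := h; omega

/-- The body of an abstraction has a smaller size. -/
def BodySz (n : ℕ) : {T : Ty S} → Tm ob Δ Γ T → Prop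
  | .proc, _ => True
  | .pabs _, P => ∃ k < n, Sz k P.pbody
  | .nabs _, P => ∃ k < n, Sz k P.nbody

theorem Sz.bodySz {T : Ty S} {n : ℕ} {P : Tm ob Δ Γ T} (h : Sz n P) : BodySz n P := by
  induction h with
  | @struct Δ Γ T n P Q h1 _ ih =>
    cases T with
    | proc => trivial
    | pabs T => exact ih.imp fun k hk => ⟨hk.1, hk.2.struct h1.pbody⟩
    | nabs T => exact ih.imp fun k hk => ⟨hk.1, hk.2.struct h1.nbody⟩
  | pabs h _ => exact ⟨_, Nat.lt_succ_self _, h⟩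
  | nabs h _ => exact ⟨_, Nat.lt_succ_self _, h⟩
  | _ => trivial

/-- Replacing variables by variables does not change η-long normal forms, except for names and
variables occurring in them. -/
theorem Sz.sub_ofRen {T : Ty S} {n : ℕ} {P : Tm ob Δ Γ T} (h : Sz n P) (ρ : NSub Δ Δ')
    (r : Ren Γ Γ') : Sz n (P.sub ρ (PSub.ofRen ob Δ' r)) := by
  induction h generalizing Δ' Γ' with
  | struct h1 _ ih => exact (ih ρ r).struct (h1.sub _ _)
  | nil => exact .nil
  | par _ _ ih ih' => exact .par (ih ρ r) (ih' ρ r)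
  | inp m _ ih =>
    refine .inp _ ?_
    rw [PSub.lift_ofRen]
    exact ih ρ _
  | out m _ ih => exact .out _ (ih ρ r)
  | var X => exact .var _
  | papp X _ ih => exact .papp _ (ih ρ r)
  | napp X d => exact .napp _ _
  | pabs _ ih =>
    refine .pabs (.struct (SC.sub_pbody _ _ _).symm ?_)
    rw [PSub.lift_ofRen]
    exact ih ρ _
  | nabs _ ih =>
    exact .nabs (.struct (SC.sub_nbody _ _ _).symm (ih (ρ.lift _) r))

theorem Sz.wk {T U : Ty S} {n : ℕ} {P : Tm ob Δ Γ T} (h : Sz n P) : Sz n (P.wk U) := by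
  rw [Tm.wk, Tm.ren_eq_sub]
  exact h.sub_ofRen _ _

/-- The consumed prefix counts for one, so the size drops although the other components stay. -/
theorem Sz.of_inStep {s : S} {m : Nm Δ s} {n : ℕ} {P : Tm ob Δ Γ Ty.proc}
    {P' : Tm ob Δ (ob s :: Γ) Ty.proc} (h : Sz n P) (hP : InStep m P P') :
    ∃ k < n, Sz k P' := by
  obtain ⟨P₁, R, h1, h2⟩ := InStep.iff_comps.1 hP
  obtain ⟨_, l, ⟨A, k, hA, hk, rfl⟩, hl, rfl⟩ := h.of_comps h1
  exact ⟨k + l, by omega, ((hk.struct (Tm.cl_eq.1 hA)).par hl.wk).struct h2.symm⟩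

end sizes

/-! ### HO-IO bisimilarity in terms of components -/

/-- Inputs are set apart because their clause compares whole derivatives, continuation and remaining
components together, and so does not relate one component to another. -/
def Pr.IsInp {Δ : List S} {Γ : List (Ty S)} : Pr ob Δ Γ → Prop
  | .inp _ _ => True
  | _ => False

/-- The relation on components other than inputs induced by a relation on terms. -/
inductive PrRel (R : TRel ob) {Δ : List S} {Γ : List (Ty S)} : Pr ob Δ Γ → Pr ob Δ Γ → Prop
  | out {s : S} (m : Nm Δ s) {a b : Cl ob Δ Γ (ob s)} (A B : Tm ob Δ Γ (ob s)) :
      A.cl = a → B.cl = b → R A B → PrRel R (.out m a) (.out m b)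
  | var (X : Var Γ Ty.proc) : PrRel R (.var X) (.var X)
  | papp {T : Ty S} (X : Var Γ (Ty.pabs T)) {a b : Cl ob Δ Γ T} (A B : Tm ob Δ Γ T) :
      A.cl = a → B.cl = b → R A B → PrRel R (.papp X a) (.papp X b)
  | napp {s : S} (X : Var Γ (Ty.nabs s)) (d : Nm Δ s) : PrRel R (.napp X d) (.napp X d)

/-- `Q` answers the moves of `P` in the HO-IO game, with results in `R`. -/
structure Sim (R : TRel ob) {Δ : List S} {Γ : List (Ty S)} (P Q : Tm ob Δ Γ Ty.proc) :
    Prop where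
  comp : ∀ (p : Pr ob Δ Γ) (P' : Tm ob Δ Γ Ty.proc), ¬ p.IsInp → P.comps = p ::ₘ P'.comps →
    ∃ (q : Pr ob Δ Γ) (Q' : Tm ob Δ Γ Ty.proc),
      Q.comps = q ::ₘ Q'.comps ∧ PrRel R p q ∧ R P' Q'
  inp : ∀ {s : S} (m : Nm Δ s) (P' : Tm ob Δ (ob s :: Γ) Ty.proc), InStep m P P' →
    ∃ Q' : Tm ob Δ (ob s :: Γ) Ty.proc, InStep m Q Q' ∧ R P' Q'

/-- One round of the HO-IO game, at every type. -/
def Bis (R : TRel ob) {Δ : List S} {Γ : List (Ty S)} :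
    {T : Ty S} → Tm ob Δ Γ T → Tm ob Δ Γ T → Prop
  | .proc, P, Q => Sim R P Q ∧ Sim R Q P
  | .pabs _, P, Q => R P.pbody Q.pbody
  | .nabs _, P, Q => R P.nbody Q.nbody

/-- Strong HO-IO bisimilarity as a type-indexed relation. -/
abbrev IORel : TRel ob := fun _ _ _ P Q => HOIOBisimilar P Q

/-- Closure of a relation under HO-IO bisimilarity (by union) and structural congruence. -/
def UpTo (R : TRel ob) : TRel ob := fun _ _ _ P Q =>
  ∃ P' Q', SC P P' ∧ SC Q' Q ∧ (R P' Q' ∨ HOIOBisimilar P' Q')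

section game

variable {R R' : TRel ob} {Δ Δ' : List S} {Γ Γ' : List (Ty S)}

theorem PrRel.not_inp_left {p q : Pr ob Δ Γ} (h : PrRel R p q) : ¬ p.IsInp := by
  cases h <;> exact id

theorem PrRel.not_inp_right {p q : Pr ob Δ Γ} (h : PrRel R p q) : ¬ q.IsInp := by
  cases h <;> exact id

theorem PrRel.mono (hR : ∀ ⦃Δ Γ T⦄ ⦃P Q : Tm ob Δ Γ T⦄, R P Q → R' P Q) {p q : Pr ob Δ Γ}
    (h : PrRel R p q) : PrRel R' p q := by
  cases h with
  | out m A B hA hB h => exact .out m A B hA hB (hR h)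
  | var X => exact .var X
  | papp X A B hA hB h => exact .papp X A B hA hB (hR h)
  | napp X d => exact .napp X d

theorem PrRel.symm (hR : ∀ ⦃Δ Γ T⦄ ⦃P Q : Tm ob Δ Γ T⦄, R P Q → R Q P) {p q : Pr ob Δ Γ}
    (h : PrRel R p q) : PrRel R q p := by
  cases h with
  | out m A B hA hB h => exact .out m B A hB hA (hR h)
  | var X => exact .var X
  | papp X A B hA hB h => exact .papp X B A hB hA (hR h)
  | napp X d => exact .napp X d

theorem PrRel.refl (hR : ∀ ⦃Δ Γ T⦄ (P : Tm ob Δ Γ T), R P P) {p : Pr ob Δ Γ}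
    (h : ¬ p.IsInp) : PrRel R p p := by
  cases p with
  | out m a => obtain ⟨A, rfl⟩ := a.exists_rep'; exact .out m A A rfl rfl (hR A)
  | inp m a => exact absurd trivial h
  | var X => exact .var X
  | papp X a => obtain ⟨A, rfl⟩ := a.exists_rep'; exact .papp X A A rfl rfl (hR A)
  | napp X d => exact .napp X d

theorem Sim.mono (hR : ∀ ⦃Δ Γ T⦄ ⦃P Q : Tm ob Δ Γ T⦄, R P Q → R' P Q)
    {P Q : Tm ob Δ Γ Ty.proc} (h : Sim R P Q) : Sim R' P Q where
  comp p P' hp hP := by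
    obtain ⟨q, Q', h1, h2, h3⟩ := h.comp p P' hp hP
    exact ⟨q, Q', h1, h2.mono hR, hR h3⟩
  inp m P' hP := by
    obtain ⟨Q', h1, h2⟩ := h.inp m P' hP
    exact ⟨Q', h1, hR h2⟩

theorem Sim.struct {P Q P' Q' : Tm ob Δ Γ Ty.proc} (h : Sim R P Q) (hP : SC P P')
    (hQ : SC Q Q') : Sim R P' Q' where
  comp p P₁ hp hP₁ := by
    rw [← hQ.comps_eq]
    exact h.comp p P₁ hp (by rw [hP.comps_eq, hP₁])
  inp m P₁ hP₁ := by
    obtain ⟨Q₁, h1, h2⟩ := h.inp m P₁ (.struct hP hP₁ (SC.refl _))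
    exact ⟨Q₁, .struct hQ.symm h1 (SC.refl _), h2⟩

theorem Bis.mono (hR : ∀ ⦃Δ Γ T⦄ ⦃P Q : Tm ob Δ Γ T⦄, R P Q → R' P Q) {T : Ty S}
    {P Q : Tm ob Δ Γ T} (h : Bis R P Q) : Bis R' P Q := by
  cases T with
  | proc => exact ⟨h.1.mono hR, h.2.mono hR⟩
  | pabs T => exact hR h
  | nabs s => exact hR h

theorem Bis.symm (hR : ∀ ⦃Δ Γ T⦄ ⦃P Q : Tm ob Δ Γ T⦄, R P Q → R Q P) {T : Ty S}
    {P Q : Tm ob Δ Γ T} (h : Bis R P Q) : Bis R Q P := by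
  cases T with
  | proc => exact ⟨h.2, h.1⟩
  | pabs T => exact hR h
  | nabs s => exact hR h

theorem Bis.struct
    (hR : ∀ ⦃Δ Γ T⦄ ⦃P Q P' Q' : Tm ob Δ Γ T⦄, R P Q → SC P P' → SC Q Q' → R P' Q')
    {T : Ty S} {P Q P' Q' : Tm ob Δ Γ T} (h : Bis R P Q) (hP : SC P P') (hQ : SC Q Q') :
    Bis R P' Q' := by
  cases T with
  | proc => exact ⟨h.1.struct hP hQ, h.2.struct hQ hP⟩
  | pabs T => exact hR h hP.pbody hQ.pbody
  | nabs s => exact hR h hP.nbody hQ.nbody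

theorem IsHOIOBisim.sim
    {R : ∀ {Δ : List S} {Γ : List (Ty S)} {T : Ty S}, Tm ob Δ Γ T → Tm ob Δ Γ T → Prop}
    (hR : IsHOIOBisim R) {P Q : Tm ob Δ Γ Ty.proc} (h : R P Q) :
    Sim (fun _ _ _ P Q => R P Q) P Q where
  comp p P' hp hP := by
    cases p with
    | out m a =>
      obtain ⟨A, rfl⟩ := a.exists_rep'
      obtain ⟨B, Q', h1, h2, h3⟩ := hR.out h m A P' (OutStep.iff_comps.2 hP)
      exact ⟨_, Q', OutStep.iff_comps.1 h1, .out m A B rfl rfl h2, h3⟩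
    | inp m a => exact absurd trivial hp
    | var X =>
      obtain ⟨Q', h1, h2⟩ := hR.var h X P' ((Tm.comps_eq_cons_iff (Tm.comps_var X)).1 hP)
      exact ⟨_, Q', (Tm.comps_eq_cons_iff (Tm.comps_var X)).2 h1, .var X, h2⟩
    | papp X a =>
      obtain ⟨A, rfl⟩ := a.exists_rep'
      obtain ⟨B, Q', h1, h2, h3⟩ :=
        hR.papp h X A P' ((Tm.comps_eq_cons_iff (Tm.comps_papp X A)).1 hP)
      exact ⟨_, Q', (Tm.comps_eq_cons_iff (Tm.comps_papp X B)).2 h1,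
        .papp X A B rfl rfl h2, h3⟩
    | napp X d =>
      obtain ⟨Q', h1, h2⟩ := hR.napp h X d P' ((Tm.comps_eq_cons_iff (Tm.comps_napp X d)).1 hP)
      exact ⟨_, Q', (Tm.comps_eq_cons_iff (Tm.comps_napp X d)).2 h1, .napp X d, h2⟩
  inp m P' hP := hR.inp h m P' hP

/-- Closure under congruence (`hsc`) is needed because components hold classes: the answer may come
with another representative of the emitted term or argument. -/
theorem isHOIOBisim_of_bis (hs : ∀ ⦃Δ Γ T⦄ ⦃P Q : Tm ob Δ Γ T⦄, R P Q → R Q P)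
    (hsc : ∀ ⦃Δ Γ T⦄ ⦃P Q P' Q' : Tm ob Δ Γ T⦄, R P Q → SC P P' → SC Q Q' → R P' Q')
    (hb : ∀ ⦃Δ Γ T⦄ ⦃P Q : Tm ob Δ Γ T⦄, R P Q → Bis R P Q) :
    IsHOIOBisim (ob := ob) (fun P Q => R P Q) where
  symm h := hs h
  pabs h := hb h
  nabs h := hb h
  inp h _ m P' hP := (hb h).1.inp m P' hP
  out h _ m A P' hP := by
    obtain ⟨q, Q', h1, h2, h3⟩ := (hb h).1.comp (Pr.out m A.cl) P' id (OutStep.iff_comps.1 hP)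
    cases h2 with
    | out _ A' B hA hB hAB =>
      subst hB
      exact ⟨B, Q', OutStep.iff_comps.2 h1, hsc hAB (Tm.cl_eq.1 hA) (SC.refl _), h3⟩
  var h X P' hP := by
    obtain ⟨q, Q', h1, h2, h3⟩ := (hb h).1.comp (Pr.var X) P' id
      ((Tm.comps_eq_cons_iff (Tm.comps_var X)).2 hP)
    cases h2
    exact ⟨Q', (Tm.comps_eq_cons_iff (Tm.comps_var X)).1 h1, h3⟩
  papp h _ X A P' hP := by
    obtain ⟨q, Q', h1, h2, h3⟩ := (hb h).1.comp (Pr.papp X A.cl) P' id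
      ((Tm.comps_eq_cons_iff (Tm.comps_papp X A)).2 hP)
    cases h2 with
    | papp _ A' B hA hB hAB =>
      subst hB
      exact ⟨B, Q', (Tm.comps_eq_cons_iff (Tm.comps_papp X B)).1 h1,
        hsc hAB (Tm.cl_eq.1 hA) (SC.refl _), h3⟩
  napp h _ X d P' hP := by
    obtain ⟨q, Q', h1, h2, h3⟩ := (hb h).1.comp (Pr.napp X d) P' id
      ((Tm.comps_eq_cons_iff (Tm.comps_napp X d)).2 hP)
    cases h2
    exact ⟨Q', (Tm.comps_eq_cons_iff (Tm.comps_napp X d)).1 h1, h3⟩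

/-! ### HO-IO bisimilarity as a greatest fixed point, and up-to techniques -/

theorem HOIOBisimilar.symm {T : Ty S} {P Q : Tm ob Δ Γ T} (h : HOIOBisimilar P Q) :
    HOIOBisimilar Q P := by
  obtain ⟨R, hR, h⟩ := h
  exact ⟨R, hR, hR.symm h⟩

theorem HOIOBisimilar.bis {T : Ty S} {P Q : Tm ob Δ Γ T} (h : HOIOBisimilar P Q) :
    Bis IORel P Q := by
  obtain ⟨R, hR, h⟩ := h
  refine Bis.mono (R := fun _ _ _ P Q => R P Q) (fun _ _ _ _ _ h => ⟨R, hR, h⟩) ?_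
  cases T with
  | proc => exact ⟨hR.sim h, hR.sim (hR.symm h)⟩
  | pabs T => exact hR.pabs h
  | nabs s => exact hR.nabs h

theorem UpTo.of_rel {T : Ty S} {P Q : Tm ob Δ Γ T} (h : R P Q) : UpTo R P Q :=
  ⟨P, Q, SC.refl _, SC.refl _, .inl h⟩

theorem UpTo.of_io ⦃Δ : List S⦄ ⦃Γ : List (Ty S)⦄ ⦃T : Ty S⦄ ⦃P Q : Tm ob Δ Γ T⦄
    (h : HOIOBisimilar P Q) : UpTo R P Q :=
  ⟨P, Q, SC.refl _, SC.refl _, .inr h⟩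

theorem UpTo.struct ⦃Δ : List S⦄ ⦃Γ : List (Ty S)⦄ ⦃T : Ty S⦄ ⦃P Q P' Q' : Tm ob Δ Γ T⦄
    (h : UpTo R P Q) (hP : SC P P') (hQ : SC Q Q') : UpTo R P' Q' := by
  obtain ⟨P₁, Q₁, h1, h2, h3⟩ := h
  exact ⟨P₁, Q₁, hP.symm.trans h1, h2.trans hQ, h3⟩

/-- Coinduction for HO-IO bisimilarity, up to structural congruence and bisimilarity. -/
theorem HOIOBisimilar.of_upTo (hs : ∀ ⦃Δ Γ T⦄ ⦃P Q : Tm ob Δ Γ T⦄, R P Q → R Q P)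
    (hb : ∀ ⦃Δ Γ T⦄ ⦃P Q : Tm ob Δ Γ T⦄, R P Q → Bis (UpTo R) P Q) {T : Ty S}
    {P Q : Tm ob Δ Γ T} (h : UpTo R P Q) : HOIOBisimilar P Q := by
  refine ⟨fun P Q => UpTo R P Q, isHOIOBisim_of_bis ?_ UpTo.struct ?_, h⟩
  · rintro Δ Γ T P Q ⟨P₁, Q₁, h1, h2, h3⟩
    exact ⟨Q₁, P₁, h2.symm, h1.symm, h3.imp (fun h => hs h) HOIOBisimilar.symm⟩
  · rintro Δ Γ T P Q ⟨P₁, Q₁, h1, h2, h3⟩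
    have h4 : Bis (UpTo R) P₁ Q₁ := h3.elim (fun h => hb h) fun h => h.bis.mono UpTo.of_io
    exact h4.struct UpTo.struct h1.symm h2

theorem HOIOBisimilar.coind (hs : ∀ ⦃Δ Γ T⦄ ⦃P Q : Tm ob Δ Γ T⦄, R P Q → R Q P)
    (hb : ∀ ⦃Δ Γ T⦄ ⦃P Q : Tm ob Δ Γ T⦄, R P Q → Bis (UpTo R) P Q) {T : Ty S}
    {P Q : Tm ob Δ Γ T} (h : R P Q) : HOIOBisimilar P Q :=
  .of_upTo hs hb (.of_rel h)

theorem HOIOBisimilar.of_bis {T : Ty S} {P Q : Tm ob Δ Γ T} (h : Bis IORel P Q) :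
    HOIOBisimilar P Q :=
  .coind (R := fun _ _ _ P Q => Bis IORel P Q)
    (fun _ _ _ _ _ h => Bis.symm (R := IORel) (fun _ _ _ _ _ h => HOIOBisimilar.symm h) h)
    (fun _ _ _ _ _ h => h.mono UpTo.of_io) h

theorem HOIOBisimilar.of_sc {T : Ty S} {P Q : Tm ob Δ Γ T} (h : SC P Q) :
    HOIOBisimilar P Q := by
  have hsim : ∀ {Δ : List S} {Γ : List (Ty S)} {P Q : Tm ob Δ Γ Ty.proc}, SC P Q →
      Sim (UpTo fun _ _ _ P Q => SC P Q) P Q := by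
    intro Δ Γ P Q h
    refine ⟨fun p P' hp hP => ⟨p, P', by rw [← h.comps_eq, hP],
      .refl (fun _ _ _ P => .of_rel (SC.refl P)) hp, .of_rel (SC.refl _)⟩, fun m P' hP =>
      ⟨P', .struct h.symm hP (SC.refl _), .of_rel (SC.refl _)⟩⟩
  refine .coind (R := fun _ _ _ P Q => SC P Q) (fun _ _ _ _ _ h => SC.symm h) ?_ h
  intro Δ Γ T P Q h
  cases T with
  | proc => exact ⟨hsim h, hsim h.symm⟩
  | pabs T => exact .of_rel h.pbody
  | nabs s => exact .of_rel h.nbody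

theorem HOIOBisimilar.refl {T : Ty S} (P : Tm ob Δ Γ T) : HOIOBisimilar P P := .of_sc (SC.refl P)

theorem HOIOBisimilar.struct {T : Ty S} {P Q P' Q' : Tm ob Δ Γ T} (h : HOIOBisimilar P Q)
    (hP : SC P P') (hQ : SC Q Q') : HOIOBisimilar P' Q' :=
  -- With the empty candidate, the up-to closure is bisimilarity modulo congruence.
  .of_upTo (R := fun _ _ _ _ _ => False) (fun _ _ _ _ _ h => h) (fun _ _ _ _ _ h => h.elim)
    ⟨P, Q, hP.symm, hQ, .inr h⟩

/-! ### Moves of instances -/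

theorem Tm.comps_sub_cons {P P' : Tm ob Δ Γ Ty.proc} {p : Pr ob Δ Γ} {p' : Pr ob Δ' Γ'}
    {ρ : NSub Δ Δ'} {σ : PSub ob Δ' Γ Γ'} (hP : P.comps = p ::ₘ P'.comps)
    (hp : p.sub ρ σ = {p'}) : (P.sub ρ σ).comps = p' ::ₘ (P'.sub ρ σ).comps := by
  rw [Tm.comps_sub, Tm.comps_sub, hP, Multiset.cons_bind, hp, Multiset.singleton_add]

/-- If every component has exactly one image, each component of the instance comes from one of the
original, and so does what remains. -/
theorem Tm.comps_sub_eq_cons {P : Tm ob Δ Γ Ty.proc} {R : Tm ob Δ' Γ' Ty.proc}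
    {p' : Pr ob Δ' Γ'} {ρ : NSub Δ Δ'} {σ : PSub ob Δ' Γ Γ'}
    (hs : ∀ p ∈ P.comps, ∃ p', Pr.sub ρ σ p = {p'})
    (h : (P.sub ρ σ).comps = p' ::ₘ R.comps) :
    ∃ (p : Pr ob Δ Γ) (P' : Tm ob Δ Γ Ty.proc),
      P.comps = p ::ₘ P'.comps ∧ Pr.sub ρ σ p = {p'} ∧ SC R (P'.sub ρ σ) := by
  have hmem : p' ∈ P.comps.bind (Pr.sub ρ σ) := by
    rw [← Tm.comps_sub, h]
    exact Multiset.mem_cons_self _ _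
  obtain ⟨p, hp, hpp'⟩ := Multiset.mem_bind.1 hmem
  obtain ⟨p'', hp''⟩ := hs p hp
  rw [hp'', Multiset.mem_singleton] at hpp'
  subst hpp'
  obtain ⟨P', hP'⟩ := Tm.exists_comps_eq_cons hp
  refine ⟨p, P', hP', hp'', Tm.comps_eq_iff.1 ?_⟩
  rw [Tm.comps_sub_cons hP' hp'', Multiset.cons_inj_right] at h
  exact h.symm

theorem InStep.sub {s : S} {m : Nm Δ s} {P : Tm ob Δ Γ Ty.proc}
    {P' : Tm ob Δ (ob s :: Γ) Ty.proc} (h : InStep m P P') (ρ : NSub Δ Δ')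
    (σ : PSub ob Δ' Γ Γ') : InStep (m.nsub ρ) (P.sub ρ σ) (P'.sub ρ (σ.lift (ob s))) := by
  obtain ⟨P₁, R, h1, h2⟩ := InStep.iff_comps.1 h
  refine InStep.iff_comps.2 ⟨_, _, Tm.comps_sub_cons h1 rfl, (h2.sub _ _).trans ?_⟩
  rw [← Tm.wk_sub_lift]
  exact SC.refl _

/-- If non-inputs become single non-inputs, the substitution creates no input, so the input made by
the instance was already there. -/
theorem InStep.of_sub {s : S} {m : Nm Δ' s} {P : Tm ob Δ Γ Ty.proc}
    {P'' : Tm ob Δ' (ob s :: Γ') Ty.proc} {ρ : NSub Δ Δ'} {σ : PSub ob Δ' Γ Γ'}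
    (hs : ∀ p ∈ P.comps, ¬ p.IsInp → ∃ p', Pr.sub ρ σ p = {p'} ∧ ¬ p'.IsInp)
    (h : InStep m (P.sub ρ σ) P'') :
    ∃ (m₀ : Nm Δ s) (P' : Tm ob Δ (ob s :: Γ) Ty.proc),
      m₀.nsub ρ = m ∧ InStep m₀ P P' ∧ SC P'' (P'.sub ρ (σ.lift (ob s))) := by
  obtain ⟨P₁, R, h1, h2⟩ := InStep.iff_comps.1 h
  have hs' : ∀ p ∈ P.comps, ∃ p', Pr.sub ρ σ p = {p'} := by
    intro p hp
    by_cases hi : p.IsInp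
    · cases p with
      | inp m a => exact ⟨_, rfl⟩
      | _ => exact hi.elim
    · obtain ⟨p', h, -⟩ := hs p hp hi
      exact ⟨p', h⟩
  obtain ⟨p, P', h3, h4, h5⟩ := Tm.comps_sub_eq_cons hs' h1
  by_cases hi : p.IsInp
  · cases p with
    | inp m₀ a =>
      obtain ⟨A, rfl⟩ := a.exists_rep'
      have h6 := Multiset.singleton_inj.1 h4
      injection h6 with h7 h8 h9
      subst h7
      obtain rfl := eq_of_heq h8
      have h10 : SC (A.sub ρ (σ.lift _)) P₁ := Tm.cl_eq.1 (eq_of_heq h9)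
      refine ⟨m₀, Tm.par A (P'.wk _), rfl, InStep.iff_comps.2 ⟨A, P', h3, SC.refl _⟩, ?_⟩
      refine h2.trans (SC.par h10.symm ?_)
      change SC _ ((P'.wk _).sub ρ (σ.lift _))
      rw [Tm.wk_sub_lift]
      exact h5.wk
    | _ => exact hi.elim
  · obtain ⟨p', h6, h7⟩ := hs p (by rw [h3]; exact Multiset.mem_cons_self _ _) hi
    rw [h6] at h4
    rw [Multiset.singleton_inj.1 h4] at h7
    exact absurd trivial h7

theorem InStep.of_par {s : S} {m : Nm Δ s} {P Q : Tm ob Δ Γ Ty.proc}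
    {R : Tm ob Δ (ob s :: Γ) Ty.proc} (h : InStep m (Tm.par P Q) R) :
    (∃ P', InStep m P P' ∧ SC R (Tm.par P' (Q.wk _))) ∨
    (∃ Q', InStep m Q Q' ∧ SC R (Tm.par (P.wk _) Q')) := by
  obtain ⟨P₁, R', h1, h2⟩ := InStep.iff_comps.1 h
  rw [Tm.comps_par] at h1
  rcases Tm.comps_add_eq_cons h1 with ⟨P', h3, h4⟩ | ⟨Q', h3, h4⟩
  · refine .inl ⟨_, InStep.iff_comps.2 ⟨P₁, P', h3, SC.refl _⟩, h2.trans ?_⟩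
    exact (SC.par (SC.refl _) h4.wk).trans (SC.par_assoc _ _ _).symm
  · refine .inr ⟨_, InStep.iff_comps.2 ⟨P₁, Q', h3, SC.refl _⟩, h2.trans ?_⟩
    exact (SC.par (SC.refl _) (h4.wk.trans (SC.par_comm _ _))).trans
      ((SC.par_assoc _ _ _).symm.trans (SC.par_comm _ _))

/-! ### Congruence properties -/

/-- Renamings of HO-IO bisimilar terms. -/
inductive RenRel : TRel ob
  | mk {Δ Δ' : List S} {Γ Γ' : List (Ty S)} {T : Ty S} {P Q : Tm ob Δ Γ T} (ρ : NSub Δ Δ')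
      (r : Ren Γ Γ') : HOIOBisimilar P Q →
      RenRel (P.sub ρ (PSub.ofRen ob Δ' r)) (Q.sub ρ (PSub.ofRen ob Δ' r))

theorem Pr.sub_ofRen (p : Pr ob Δ Γ) (hp : ¬ p.IsInp) (ρ : NSub Δ Δ') (r : Ren Γ Γ') :
    ∃ p', p.sub ρ (PSub.ofRen ob Δ' r) = {p'} ∧ ¬ p'.IsInp := by
  cases p with
  | out m a => exact ⟨_, rfl, id⟩
  | inp m a => exact absurd trivial hp
  | var X => exact ⟨_, Tm.comps_var _, id⟩
  | papp X a => exact ⟨_, Tm.comps_papp _ _, id⟩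
  | napp X d => exact ⟨_, Tm.comps_napp _ _, id⟩

theorem Pr.exists_sub_ofRen (p : Pr ob Δ Γ) (ρ : NSub Δ Δ') (r : Ren Γ Γ') :
    ∃ p', p.sub ρ (PSub.ofRen ob Δ' r) = {p'} := by
  by_cases hp : p.IsInp
  · cases p with
    | inp m a => exact ⟨_, rfl⟩
    | _ => exact hp.elim
  · exact (p.sub_ofRen hp ρ r).imp fun _ h => h.1

theorem PrRel.sub_ofRen {p q : Pr ob Δ Γ} (h : PrRel IORel p q) (ρ : NSub Δ Δ')
    (r : Ren Γ Γ') : ∃ p' q', p.sub ρ (PSub.ofRen ob Δ' r) = {p'} ∧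
      q.sub ρ (PSub.ofRen ob Δ' r) = {q'} ∧ PrRel RenRel p' q' := by
  cases h with
  | out m A B hA hB h =>
    subst hA hB
    exact ⟨_, _, rfl, rfl, .out _ _ _ rfl rfl (.mk ρ r h)⟩
  | var X => exact ⟨_, _, Tm.comps_var _, Tm.comps_var _, .var _⟩
  | papp X A B hA hB h =>
    subst hA hB
    rw [Pr.sub_papp, Pr.sub_papp]
    exact ⟨_, _, Tm.comps_papp _ _, Tm.comps_papp _ _, .papp _ _ _ rfl rfl (.mk ρ r h)⟩
  | napp X d => exact ⟨_, _, Tm.comps_napp _ _, Tm.comps_napp _ _, .napp _ _⟩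

theorem Sim.sub_ofRen {P Q : Tm ob Δ Γ Ty.proc} (h : Sim IORel P Q) (ρ : NSub Δ Δ')
    (r : Ren Γ Γ') : Sim (UpTo RenRel) (P.sub ρ (PSub.ofRen ob Δ' r))
      (Q.sub ρ (PSub.ofRen ob Δ' r)) where
  comp p' P'' hp' hP'' := by
    obtain ⟨p, P', h1, h2, h3⟩ :=
      Tm.comps_sub_eq_cons (fun p _ => p.exists_sub_ofRen ρ r) hP''
    have hp : ¬ p.IsInp := by
      intro hi
      cases p with
      | inp m a =>
        rw [← Multiset.singleton_inj.1 h2] at hp'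
        exact hp' trivial
      | _ => exact hi.elim
    obtain ⟨q, Q', h4, h5, h6⟩ := h.comp p P' hp h1
    obtain ⟨p₁, q', h7, h8, h9⟩ := h5.sub_ofRen ρ r
    rw [h7, Multiset.singleton_inj] at h2
    subst h2
    exact ⟨q', _, Tm.comps_sub_cons h4 h8, h9.mono fun _ _ _ _ _ h => UpTo.of_rel h,
      ⟨_, _, h3, SC.refl _, .inl (.mk ρ r h6)⟩⟩
  inp m P'' hP'' := by
    obtain ⟨m₀, P', rfl, h1, h2⟩ := hP''.of_sub fun p _ hp => p.sub_ofRen hp ρ r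
    obtain ⟨Q', h3, h4⟩ := h.inp m₀ P' h1
    refine ⟨_, h3.sub ρ _, _, _, h2, SC.refl _, .inl ?_⟩
    rw [PSub.lift_ofRen]
    exact .mk ρ _ h4

theorem Bis.sub_ofRen {T : Ty S} {P Q : Tm ob Δ Γ T} (h : HOIOBisimilar P Q)
    (ρ : NSub Δ Δ') (r : Ren Γ Γ') :
    Bis (UpTo RenRel) (P.sub ρ (PSub.ofRen ob Δ' r)) (Q.sub ρ (PSub.ofRen ob Δ' r)) := by
  cases T with
  | proc => exact ⟨h.bis.1.sub_ofRen ρ r, h.bis.2.sub_ofRen ρ r⟩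
  | pabs T =>
    refine ⟨_, _, SC.sub_pbody _ _ _, (SC.sub_pbody _ _ _).symm, .inl ?_⟩
    rw [PSub.lift_ofRen]
    exact .mk ρ _ h.bis
  | nabs s =>
    exact ⟨_, _, SC.sub_nbody _ _ _, (SC.sub_nbody _ _ _).symm, .inl (.mk (ρ.lift s) r h.bis)⟩

/-- Identifying names is harmless: it may enable new communications, but the game has no τ-clause,
and the other moves come from moves of the original terms. -/
theorem HOIOBisimilar.sub_ofRen {T : Ty S} {P Q : Tm ob Δ Γ T} (h : HOIOBisimilar P Q)
    (ρ : NSub Δ Δ') (r : Ren Γ Γ') :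
    HOIOBisimilar (P.sub ρ (PSub.ofRen ob Δ' r)) (Q.sub ρ (PSub.ofRen ob Δ' r)) := by
  refine .coind (R := RenRel) ?_ ?_ (.mk ρ r h)
  · rintro _ _ _ _ _ ⟨ρ, r, h⟩
    exact .mk ρ r h.symm
  · rintro _ _ _ _ _ ⟨ρ, r, h⟩
    exact .sub_ofRen h ρ r

theorem HOIOBisimilar.wk {T U : Ty S} {P Q : Tm ob Δ Γ T} (h : HOIOBisimilar P Q) :
    HOIOBisimilar (P.wk U) (Q.wk U) := by
  simp only [Tm.wk, Tm.ren_eq_sub]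
  exact h.sub_ofRen _ _

/-- Parallel compositions of HO-IO bisimilar processes. -/
inductive ParRel : TRel ob
  | mk {Δ : List S} {Γ : List (Ty S)} {P Q P' Q' : Tm ob Δ Γ Ty.proc} : HOIOBisimilar P Q →
      HOIOBisimilar P' Q' → ParRel (Tm.par P P') (Tm.par Q Q')

theorem Sim.par {P Q P' Q' : Tm ob Δ Γ Ty.proc} (h : HOIOBisimilar P Q)
    (h' : HOIOBisimilar P' Q') : Sim (UpTo ParRel) (Tm.par P P') (Tm.par Q Q') where
  comp p R hp hR := by
    rw [Tm.comps_par] at hR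
    rcases Tm.comps_add_eq_cons hR with ⟨P₁, h1, h2⟩ | ⟨P₁, h1, h2⟩
    · obtain ⟨q, Q₁, h3, h4, h5⟩ := h.bis.1.comp p P₁ hp h1
      exact ⟨q, Tm.par Q₁ Q', by rw [Tm.comps_par, Tm.comps_par, h3, Multiset.cons_add],
        h4.mono UpTo.of_io, ⟨_, _, h2, SC.refl _, .inl (.mk h5 h')⟩⟩
    · obtain ⟨q, Q₁, h3, h4, h5⟩ := h'.bis.1.comp p P₁ hp h1
      exact ⟨q, Tm.par Q Q₁, by rw [Tm.comps_par, Tm.comps_par, h3, Multiset.add_cons],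
        h4.mono UpTo.of_io, ⟨_, _, h2, SC.refl _, .inl (.mk h h5)⟩⟩
  inp m R hR := by
    rcases hR.of_par with ⟨P₁, h1, h2⟩ | ⟨P₁, h1, h2⟩
    · obtain ⟨Q₁, h3, h4⟩ := h.bis.1.inp m P₁ h1
      exact ⟨_, .parL _ h3, _, _, h2, SC.refl _, .inl (.mk h4 h'.wk)⟩
    · obtain ⟨Q₁, h3, h4⟩ := h'.bis.1.inp m P₁ h1
      exact ⟨_, .parR _ h3, _, _, h2, SC.refl _, .inl (.mk h.wk h4)⟩

/-- Without a τ-clause, every move of a parallel composition is a move of one side. -/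
theorem HOIOBisimilar.par {P Q P' Q' : Tm ob Δ Γ Ty.proc} (h : HOIOBisimilar P Q)
    (h' : HOIOBisimilar P' Q') : HOIOBisimilar (Tm.par P P') (Tm.par Q Q') := by
  refine .coind (R := ParRel) ?_ ?_ (.mk h h')
  · rintro _ _ _ _ _ ⟨h, h'⟩
    exact .mk h.symm h'.symm
  · rintro _ _ _ _ _ ⟨h, h'⟩
    exact ⟨.par h h', .par h.symm h'.symm⟩

theorem Sim.of_prime {P Q : Tm ob Δ Γ Ty.proc} {p q : Pr ob Δ Γ} (hP : P.comps = {p})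
    (hQ : Q.comps = {q}) (h : PrRel IORel p q) : Sim IORel P Q where
  comp p' P' _ hP' := by
    rw [hP] at hP'
    obtain ⟨rfl, h1⟩ := Tm.comps_singleton_eq_cons hP'
    exact ⟨q, Tm.nil, by rw [hQ, Tm.comps_nil]; rfl, h, .of_sc h1⟩
  inp m P' hP' := by
    obtain ⟨P₁, R, h1, -⟩ := InStep.iff_comps.1 hP'
    rw [hP] at h1
    obtain ⟨rfl, -⟩ := Tm.comps_singleton_eq_cons h1
    exact absurd trivial h.not_inp_left

theorem HOIOBisimilar.of_prime {P Q : Tm ob Δ Γ Ty.proc} {p q : Pr ob Δ Γ}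
    (hP : P.comps = {p}) (hQ : Q.comps = {q}) (h : PrRel IORel p q) : HOIOBisimilar P Q :=
  .of_bis ⟨.of_prime hP hQ h,
    .of_prime hQ hP (PrRel.symm (R := IORel) (fun _ _ _ _ _ h => HOIOBisimilar.symm h) h)⟩

/-! ### Substitutivity -/

theorem HOIOBisimilar.lr_var ⦃Δ : List S⦄ ⦃Γ : List (Ty S)⦄ ⦃T : Ty S⦄ (X : Var Γ T) :
    LR IORel T (Tm.var X : Tm ob Δ Γ T) (Tm.var X) := by
  cases T with
  | proc => exact fun _ _ ρ r => .refl _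
  | pabs T =>
    exact fun _ _ ρ r => ⟨.refl _, fun A A' hA =>
      .of_prime (Tm.comps_papp _ _) (Tm.comps_papp _ _) (.papp _ _ _ rfl rfl hA.base)⟩
  | nabs s => exact fun _ _ ρ r => ⟨.refl _, fun n => .refl _⟩

/-- With only inputs at top level, the substitution acts under prefixes and the moves of the
instance are those of the term. -/
theorem Sim.sub_of_inputs {P Q : Tm ob Δ Γ Ty.proc} {ρ : NSub Δ Δ'} {σ σ' : PSub ob Δ' Γ Γ'}
    (hP : ∀ p ∈ P.comps, p.IsInp)
    (h : ∀ {s : S} (m : Nm Δ s) (P' : Tm ob Δ (ob s :: Γ) Ty.proc), InStep m P P' →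
      ∃ Q', InStep m Q Q' ∧ HOIOBisimilar (P'.sub ρ (σ.lift _)) (Q'.sub ρ (σ'.lift _))) :
    Sim IORel (P.sub ρ σ) (Q.sub ρ σ') where
  comp p' P'' hp' hP'' := by
    have hs : ∀ p ∈ P.comps, ∃ p', Pr.sub ρ σ p = {p'} ∧ p'.IsInp := by
      intro p hp
      have hi := hP p hp
      cases p with
      | inp m a => exact ⟨_, rfl, trivial⟩
      | _ => exact hi.elim
    obtain ⟨p, P', h1, h2, -⟩ :=
      Tm.comps_sub_eq_cons (fun p hp => (hs p hp).imp fun _ h => h.1) hP''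
    obtain ⟨p₁, h3, h4⟩ := hs p (by rw [h1]; exact Multiset.mem_cons_self _ _)
    rw [h3, Multiset.singleton_inj] at h2
    exact absurd (h2 ▸ h4) hp'
  inp m P'' hP'' := by
    obtain ⟨m₀, P', rfl, h1, h2⟩ := hP''.of_sub fun p hp hi => absurd (hP p hp) hi
    obtain ⟨Q', h3, h4⟩ := h m₀ P' h1
    exact ⟨_, h3.sub ρ σ', h4.struct h2.symm (SC.refl _)⟩

/-- A non-input component and its answer are split off. The rest is smaller; the component is
handled through its subterm and, if it is headed by a variable, through the relation between `σ` and
`σ'`; parallel composition puts the pieces together. Inputs cannot be split off, since their answers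
compare whole derivatives, so they are consumed only when nothing else is left. Abstractions pass to
their bodies, which are smaller. -/
theorem HOIOBisimilar.subRel_of_sz {n : ℕ} {T : Ty S} {P Q : Tm ob Δ Γ T} (hn : Sz n P)
    (h : HOIOBisimilar P Q) : SubRel IORel P Q := by
  induction n using Nat.strong_induction_on generalizing Δ Γ T with
  | _ n ih =>
  cases T with
  | pabs T =>
    obtain ⟨k, hk, hkP⟩ : ∃ k < n, Sz k P.pbody := hn.bodySz
    have hb := ih k hk hkP h.bis
    refine .of_pabs fun Δ' Γ' ρ σ σ' hσ => ⟨.of_bis ?_, fun A A' hA => ?_⟩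
    · exact (hb ρ _ _ (hσ.lift lr_var T)).base.struct (SC.sub_pbody _ _ _).symm
        (SC.sub_pbody _ _ _).symm
    · exact (hb ρ _ _ (hσ.cons hA)).base.struct (SC.papp_pbody _ _ _ _).symm
        (SC.papp_pbody _ _ _ _).symm
  | nabs s =>
    obtain ⟨k, hk, hkP⟩ : ∃ k < n, Sz k P.nbody := hn.bodySz
    have hb := ih k hk hkP h.bis
    refine .of_nabs fun Δ' Γ' ρ σ σ' hσ => ⟨.of_bis ?_, fun d => ?_⟩
    · exact (hb (ρ.lift s) _ _ (hσ.nlift s)).base.struct (SC.sub_nbody _ _ _).symm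
        (SC.sub_nbody _ _ _).symm
    · exact (hb (NSub.cons d ρ) _ _ hσ).base.struct (SC.napp_nbody _ _ _ _).symm
        (SC.napp_nbody _ _ _ _).symm
  | proc =>
    refine .of_proc fun Δ' Γ' ρ σ σ' hσ => ?_
    by_cases hP : ∀ p ∈ P.comps, p.IsInp
    · have hQ : ∀ q ∈ Q.comps, q.IsInp := by
        intro q hq
        by_contra hi
        obtain ⟨Q', hQ'⟩ := Tm.exists_comps_eq_cons hq
        obtain ⟨p, P', h1, h2, -⟩ := h.bis.2.comp q Q' hi hQ'
        exact h2.not_inp_right (hP p (by rw [h1]; exact Multiset.mem_cons_self _ _))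
      refine .of_bis ⟨.sub_of_inputs hP fun m P' hP' => ?_,
        .sub_of_inputs hQ fun m Q' hQ' => ?_⟩
      · obtain ⟨Q', h1, h2⟩ := h.bis.1.inp m P' hP'
        obtain ⟨k, hk, hkP⟩ := hn.of_inStep hP'
        exact ⟨Q', h1, (ih k hk hkP h2 ρ _ _ (hσ.lift lr_var _)).base⟩
      · obtain ⟨P', h1, h2⟩ := h.bis.2.inp m Q' hQ'
        -- The size is measured on `P` whichever side moves, hence the two uses of symmetry below.
        obtain ⟨k, hk, hkP⟩ := hn.of_inStep h1
        exact ⟨P', h1, (ih k hk hkP h2.symm ρ _ _ (hσ.lift lr_var _)).base.symm⟩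
    · push Not at hP
      obtain ⟨p, hp, hi⟩ := hP
      obtain ⟨P', hP'⟩ := Tm.exists_comps_eq_cons hp
      obtain ⟨q, Q', hQ', hpq, h'⟩ := h.bis.1.comp p P' hi hP'
      obtain ⟨k, l, hk, hl, rfl⟩ := hn.of_comps hP'
      -- The component has positive size, so the rest is strictly smaller.
      have hpos := hk.pos
      have hrest := (ih l (by omega) hl h' ρ _ _ hσ).base
      have hprime : ∃ P₁ Q₁ : Tm ob Δ Γ Ty.proc, P₁.comps = {p} ∧ Q₁.comps = {q} ∧
          HOIOBisimilar (P₁.sub ρ σ) (Q₁.sub ρ σ') := by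
        cases hpq with
        | out m A B hA hB hAB =>
          subst hA hB
          obtain ⟨A', k, hA', hkA, rfl⟩ := hk
          exact ⟨_, _, Tm.comps_out m A, Tm.comps_out m B, .of_prime (Tm.comps_out _ _)
            (Tm.comps_out _ _) (.out _ _ _ rfl rfl
              (ih k (by omega) (hkA.struct (Tm.cl_eq.1 hA')) hAB ρ _ _ hσ).base)⟩
        | var X => exact ⟨_, _, Tm.comps_var X, Tm.comps_var X, (hσ _ X).base⟩
        | papp X A B hA hB hAB =>
          subst hA hB
          obtain ⟨A', k, hA', hkA, rfl⟩ := hk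
          -- The images of `X` need logically related arguments, not just bisimilar ones; this is
          -- why the induction proves `SubRel`.
          exact ⟨_, _, Tm.comps_papp X A, Tm.comps_papp X B, (hσ _ X).papp
            (ih k (by omega) (hkA.struct (Tm.cl_eq.1 hA')) hAB ρ _ _ hσ)⟩
        | napp X d => exact ⟨_, _, Tm.comps_napp X d, Tm.comps_napp X d, (hσ _ X).napp _⟩
      obtain ⟨P₁, Q₁, h1, h2, h3⟩ := hprime
      exact (h3.par hrest).struct (((Tm.comps_eq_cons_iff h1).1 hP').sub ρ σ).symm
        (((Tm.comps_eq_cons_iff h2).1 hQ').sub ρ σ').symm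

theorem HOIOBisimilar.subRel {T : Ty S} {P Q : Tm ob Δ Γ T} (h : HOIOBisimilar P Q) :
    SubRel IORel P Q := by
  obtain ⟨n, hn⟩ := Sz.exists_size P
  exact subRel_of_sz hn h

/-- Bisimilarity implies the logical relation, so pointwise bisimilarity of substitutions is enough
from here on. -/
theorem HOIOBisimilar.lr {T : Ty S} {P Q : Tm ob Δ Γ T} (h : HOIOBisimilar P Q) :
    LR IORel T P Q := by
  have := h.subRel (NSub.id Δ) (PSub.id ob Δ Γ) (PSub.id ob Δ Γ) fun _ X => lr_var X
  rwa [Tm.sub_id, Tm.sub_id] at this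

theorem HOIOBisimilar.psub {T : Ty S} {P Q : Tm ob Δ Γ T} (h : HOIOBisimilar P Q)
    {σ σ' : PSub ob Δ Γ Γ'} (hσ : ∀ T X, HOIOBisimilar (σ T X) (σ' T X)) :
    HOIOBisimilar (P.psub σ) (Q.psub σ') := by
  simp only [Tm.psub_eq_sub]
  exact (h.subRel _ _ _ fun T X => (hσ T X).lr).base

theorem HOIOBisimilar.inst {T U : Ty S} {P Q : Tm ob Δ (T :: Γ) U} (h : HOIOBisimilar P Q)
    {A B : Tm ob Δ Γ T} (hAB : HOIOBisimilar A B) : HOIOBisimilar (P.inst A) (Q.inst B) := by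
  refine h.psub ?_
  rintro _ (_ | X)
  · exact hAB
  · exact .refl _

/-! ### HO-IO bisimilarity is contained in HO bisimilarity -/

/-- Closed terms of abstraction type are literally abstractions. The clauses that instantiate follow
from substitutivity; for τ, the output and then the input are answered, and substitutivity is
applied with the two bisimilar emitted terms. -/
theorem isHOBisim_hoio :
    IsHOBisim (ob := ob) (fun P Q => HOIOBisimilar P Q) where
  symm h := h.symm
  pabs {Δ T P' Q} h := by
    cases Q with
    | pabs Q' =>
      have hb : HOIOBisimilar P' Q' := h.bis
      exact ⟨Q', rfl, fun A => hb.inst (.refl A)⟩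
    | var X => cases X
  nabs {Δ s A Q} h := by
    cases Q with
    | nabs B => exact ⟨B, rfl, h.bis⟩
    | var X => cases X
  out h _ m A P' hP := by
    obtain ⟨R, hR, h⟩ := h
    obtain ⟨B, Q', h1, h2, h3⟩ := hR.out h m A P' hP
    exact ⟨B, Q', h1, ⟨R, hR, h2⟩, ⟨R, hR, h3⟩⟩
  inp h _ m P' hP := by
    obtain ⟨Q', h1, h2⟩ := h.bis.1.inp m P' hP
    exact ⟨Q', h1, fun A => HOIOBisimilar.inst h2 (.refl A)⟩
  tau h P' hP := by
    obtain ⟨s, m, A, P₁, P₂, h1, h2, h3⟩ := hP.exists_out_in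
    obtain ⟨R, hR, h⟩ := h
    obtain ⟨B, Q₁, h4, h5, h6⟩ := hR.out h m A P₁ h1
    obtain ⟨Q₂, h7, h8⟩ := hR.inp h6 m P₂ h2
    have hAB : HOIOBisimilar A B := ⟨R, hR, h5⟩
    have h9 : HOIOBisimilar P₂ Q₂ := ⟨R, hR, h8⟩
    exact ⟨_, .of_out_in h4 h7, (h9.inst hAB).struct h3.symm (SC.refl _)⟩

theorem HOIOBisimilar.hoBisimilarClosed {T : Ty S} {P Q : Tm ob Δ [] T}
    (h : HOIOBisimilar P Q) : HOBisimilarClosed P Q :=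
  ⟨fun P Q => HOIOBisimilar P Q, isHOBisim_hoio, h⟩

theorem HOIOBisimilar.hoBisimilar {T : Ty S} {P Q : Tm ob Δ Γ T} (h : HOIOBisimilar P Q) :
    HOBisimilar P Q :=
  fun _ => (h.psub fun _ _ => .refl _).hoBisimilarClosed

end game

/-! ### HO bisimilarity on closed terms -/

section closed

variable {Δ : List S}

theorem HOBisimilarClosed.symm {T : Ty S} {P Q : Tm ob Δ [] T} (h : HOBisimilarClosed P Q) :
    HOBisimilarClosed Q P := by
  obtain ⟨R, hR, h⟩ := h
  exact ⟨R, hR, hR.symm h⟩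

theorem HOBisimilarClosed.pbody {T : Ty S} {P Q : Tm ob Δ [] (Ty.pabs T)}
    (h : HOBisimilarClosed P Q) (A : Tm ob Δ [] T) :
    HOBisimilarClosed (P.pbody.inst A) (Q.pbody.inst A) := by
  obtain ⟨R, hR, h⟩ := h
  cases P with
  | pabs P' =>
    obtain ⟨Q', rfl, h'⟩ := hR.pabs h
    exact ⟨R, hR, h' A⟩
  | var X => cases X

theorem HOBisimilarClosed.nbody {s : S} {P Q : Tm ob Δ [] (Ty.nabs s)}
    (h : HOBisimilarClosed P Q) : HOBisimilarClosed P.nbody Q.nbody := by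
  obtain ⟨R, hR, h⟩ := h
  cases P with
  | nabs P' =>
    obtain ⟨Q', rfl, h'⟩ := hR.nabs h
    exact ⟨R, hR, h'⟩
  | var X => cases X

theorem HOBisimilarClosed.out {P Q : Tm ob Δ [] Ty.proc} (h : HOBisimilarClosed P Q) {s : S}
    {m : Nm Δ s} {A : Tm ob Δ [] (ob s)} {P' : Tm ob Δ [] Ty.proc} (hP : OutStep m A P P') :
    ∃ B Q', OutStep m B Q Q' ∧ HOBisimilarClosed A B ∧ HOBisimilarClosed P' Q' := by
  obtain ⟨R, hR, h⟩ := h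
  obtain ⟨B, Q', h1, h2, h3⟩ := hR.out h m A P' hP
  exact ⟨B, Q', h1, ⟨R, hR, h2⟩, ⟨R, hR, h3⟩⟩

theorem HOBisimilarClosed.inp {P Q : Tm ob Δ [] Ty.proc} (h : HOBisimilarClosed P Q) {s : S}
    {m : Nm Δ s} {P' : Tm ob Δ [ob s] Ty.proc} (hP : InStep m P P') :
    ∃ Q', InStep m Q Q' ∧ ∀ A, HOBisimilarClosed (P'.inst A) (Q'.inst A) := by
  obtain ⟨R, hR, h⟩ := h
  obtain ⟨Q', h1, h2⟩ := hR.inp h m P' hP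
  exact ⟨Q', h1, fun A => ⟨R, hR, h2 A⟩⟩

theorem HOBisimilarClosed.tau {P Q : Tm ob Δ [] Ty.proc} (h : HOBisimilarClosed P Q)
    {P' : Tm ob Δ [] Ty.proc} (hP : TauStep P P') :
    ∃ Q', TauStep Q Q' ∧ HOBisimilarClosed P' Q' := by
  obtain ⟨R, hR, h⟩ := h
  obtain ⟨Q', h1, h2⟩ := hR.tau h P' hP
  exact ⟨Q', h1, ⟨R, hR, h2⟩⟩

/-- The relation obtained by composing with congruence on both sides is a bisimulation: transitions
absorb congruence, and congruent abstractions have congruent bodies. -/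
theorem HOBisimilarClosed.struct {T : Ty S} {P Q P' Q' : Tm ob Δ [] T}
    (h : HOBisimilarClosed P Q) (hP : SC P P') (hQ : SC Q Q') : HOBisimilarClosed P' Q' := by
  refine ⟨fun P Q => ∃ P₁ Q₁, SC P P₁ ∧ SC Q₁ Q ∧ HOBisimilarClosed P₁ Q₁, ?_,
    P, Q, hP.symm, hQ, h⟩
  constructor
  · rintro Δ T P Q ⟨P₁, Q₁, h1, h2, h3⟩
    exact ⟨Q₁, P₁, h2.symm, h1.symm, h3.symm⟩
  · rintro Δ T P Q ⟨P₁, Q₁, h1, h2, h3⟩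
    cases Q with
    | pabs Q => exact ⟨Q, rfl, fun A => ⟨_, _, h1.pbody.inst A, h2.pbody.inst A, h3.pbody A⟩⟩
    | var X => cases X
  · rintro Δ s P Q ⟨P₁, Q₁, h1, h2, h3⟩
    cases Q with
    | nabs Q => exact ⟨Q, rfl, ⟨_, _, h1.nbody, h2.nbody, h3.nbody⟩⟩
    | var X => cases X
  · rintro Δ P Q ⟨P₁, Q₁, h1, h2, h3⟩ s m A P' hP'
    obtain ⟨B, Q', h4, h5, h6⟩ := h3.out (.struct h1.symm hP' (SC.refl _))
    exact ⟨B, Q', .struct h2.symm h4 (SC.refl _), ⟨_, _, SC.refl _, SC.refl _, h5⟩,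
      ⟨_, _, SC.refl _, SC.refl _, h6⟩⟩
  · rintro Δ P Q ⟨P₁, Q₁, h1, h2, h3⟩ s m P' hP'
    obtain ⟨Q', h4, h5⟩ := h3.inp (.struct h1.symm hP' (SC.refl _))
    exact ⟨Q', .struct h2.symm h4 (SC.refl _), fun A => ⟨_, _, SC.refl _, SC.refl _, h5 A⟩⟩
  · rintro Δ P Q ⟨P₁, Q₁, h1, h2, h3⟩ P' hP'
    obtain ⟨Q', h4, h5⟩ := h3.tau (.struct h1.symm hP' (SC.refl _))
    exact ⟨Q', .struct h2.symm h4 (SC.refl _), ⟨_, _, SC.refl _, SC.refl _, h5⟩⟩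

/-- Recovers the name passed to a trigger of name-abstraction type from the input process it emits.
-/
theorem HOBisimilarClosed.inp_nil_inj {s : S} {d d' : Nm Δ s}
    (h : HOBisimilarClosed (Tm.inp d Tm.nil : Tm ob Δ [] Ty.proc) (Tm.inp d' Tm.nil)) :
    d = d' := by
  obtain ⟨Q', h1, -⟩ := h.inp (.inp _)
  obtain ⟨P₁, R, h2, -⟩ := InStep.iff_comps.1 h1
  rw [Tm.comps_inp] at h2
  have h3 := (Tm.comps_singleton_eq_cons h2).1
  injection h3

end closed

/-! ### Triggers -/

/-- An output of a term whose type is propositionally that of the subject. -/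
def Tm.outAs {Δ : List S} {Γ : List (Ty S)} {s : S} :
    {T : Ty S} → ob s = T → Nm Δ s → Tm ob Δ Γ T → Tm ob Δ Γ Ty.proc
  | _, rfl, m, A => .out m A

def Pr.outAs {Δ : List S} {Γ : List (Ty S)} {s : S} :
    {T : Ty S} → ob s = T → Nm Δ s → Cl ob Δ Γ T → Pr ob Δ Γ
  | _, rfl, m, a => .out m a

/-- The level of a variable: the length of the scope in which it was introduced. -/
def Var.level {α : Type u} : {l : List α} → {a : α} → Var l a → ℕ
  | _ :: l, _, .zero => l.length
  | _, _, .succ X => X.level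

theorem Var.level_lt {α : Type u} {l : List α} {a : α} (X : Var l a) : X.level < l.length := by
  induction X with
  | zero => exact Nat.lt_succ_self _
  | succ X ih => exact Nat.lt_succ_of_lt ih

theorem Var.level_inj {α : Type u} {l : List α} {a b : α} (X : Var l a) (Y : Var l b)
    (h : X.level = Y.level) : (⟨a, X⟩ : Σ a, Var l a) = ⟨b, Y⟩ := by
  induction X with
  | zero =>
    cases Y with
    | zero => rfl
    | succ Y =>
      have := Y.level_lt
      simp only [Var.level] at h
      omega
  | succ X ih =>
    cases Y with
    | zero =>
      have := X.level_lt
      simp only [Var.level] at h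
      omega
    | succ Y => cases ih Y h; rfl

section triggers

variable {sel : Ty S → S} (hsel : ∀ T, ob (sel T) = T) {Δ Δ' : List S} {Γ Γ' : List (Ty S)}

theorem Tm.outAs_sub {s : S} {T : Ty S} (h : ob s = T) (m : Nm Δ s) (A : Tm ob Δ Γ T)
    (ρ : NSub Δ Δ') (σ : PSub ob Δ' Γ Γ') :
    (Tm.outAs h m A).sub ρ σ = Tm.outAs h (m.nsub ρ) (A.sub ρ σ) := by
  subst h
  rfl

theorem Tm.comps_outAs {s : S} {T : Ty S} (h : ob s = T) (m : Nm Δ s) (A : Tm ob Δ Γ T) :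
    (Tm.outAs h m A).comps = {Pr.outAs h m A.cl} := by
  subst h
  exact Tm.comps_out m A

/-- The trigger of type `T` with index `N`: a closed term that signals its use, and the argument
it is given, by an output at the `N`-th name constant. -/
def trigger (N : ℕ) : (T : Ty S) → Tm ob Δ Γ T
  | .proc => .outAs (hsel .proc) (.const N) .nil
  | .pabs T => .pabs (.outAs (hsel T) (.const N) (.var .zero))
  | .nabs s => .nabs (.outAs (hsel .proc) (.const N) (.inp (s := s) (.var .zero) .nil))

theorem trigger_sub (N : ℕ) (T : Ty S) (ρ : NSub Δ Δ') (σ : PSub ob Δ' Γ Γ') :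
    (trigger hsel N T : Tm ob Δ Γ T).sub ρ σ = trigger hsel N T := by
  cases T with
  | proc => exact Tm.outAs_sub _ _ _ _ _
  | pabs T => exact congrArg Tm.pabs (Tm.outAs_sub _ _ _ ρ (σ.lift T))
  | nabs s => exact congrArg Tm.nabs (Tm.outAs_sub _ _ _ (ρ.lift s) (σ.nlift s))

/-- The closing substitution of triggers with pairwise distinct indices, starting from `N`. -/
def trigSub (N : ℕ) (Δ : List S) (Γ : List (Ty S)) : PSub ob Δ Γ [] :=
  fun T X => trigger hsel (N + X.level) T

/-- Because indices follow levels, opening a binder gives the new variable the next constant and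
leaves the old assignments unchanged. -/
theorem trigSub_cons (N : ℕ) (T : Ty S) :
    PSub.cons (trigger hsel (N + Γ.length) T) (trigSub hsel N Δ Γ) =
      trigSub hsel N Δ (T :: Γ) := by
  apply PSub.ext
  rintro _ (_ | X) <;> rfl

theorem trigSub_nlift (N : ℕ) (s : S) :
    (trigSub hsel N Δ Γ).nlift s = trigSub hsel N (s :: Δ) Γ := by
  apply PSub.ext
  intro T X
  simp only [PSub.nlift, Tm.nsub_eq_sub]
  exact trigger_sub hsel _ T _ _

/-- The image of a component under the substitution of triggers. -/
def Pr.trig (N : ℕ) : Pr ob Δ Γ → Pr ob Δ []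
  | .out m a => .out m (a.sub (NSub.id Δ) (trigSub hsel N Δ Γ))
  | .inp m a => .inp m (a.sub (NSub.id Δ) ((trigSub hsel N Δ Γ).lift _))
  | .var X => .outAs (hsel .proc) (.const (N + X.level)) Tm.nil.cl
  | .papp (T := T) X a =>
      .outAs (hsel T) (.const (N + X.level)) (a.sub (NSub.id Δ) (trigSub hsel N Δ Γ))
  | .napp X d => .outAs (hsel .proc) (.const (N + X.level)) (Tm.inp d Tm.nil).cl

/-- A trigger in head position becomes a single output, after at most one β-step, so the components
of the instance correspond to those of the term. -/
theorem Pr.sub_trigSub (N : ℕ) (p : Pr ob Δ Γ) :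
    p.sub (NSub.id Δ) (trigSub hsel N Δ Γ) = {p.trig hsel N} := by
  cases p with
  | out m a => simp [Pr.sub, Pr.trig, Nm.nsub_id]
  | inp m a => simp [Pr.sub, Pr.trig, Nm.nsub_id]
  | var X => exact Tm.comps_outAs _ _ _
  | papp X a =>
    obtain ⟨A, rfl⟩ := a.exists_rep'
    rw [Pr.sub_papp]
    refine (SC.comps_eq (SC.pbeta _ _)).trans ?_
    rw [Tm.inst, Tm.psub_eq_sub, Tm.outAs_sub, Tm.comps_outAs]
    rfl
  | napp X d =>
    refine (SC.comps_eq (SC.nbeta _ _)).trans ?_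
    rw [Tm.ninst, Tm.nsub_eq_sub, Tm.outAs_sub, Tm.comps_outAs, Nm.nsub_id]
    rfl

theorem Pr.exists_trig_eq_out (N : ℕ) {p : Pr ob Δ Γ} (hp : ¬ p.IsInp) :
    ∃ (s : S) (m : Nm Δ s) (A : Tm ob Δ [] (ob s)), p.trig hsel N = Pr.out m A.cl := by
  have houtAs : ∀ {s : S} {T : Ty S} (h : ob s = T) (m : Nm Δ s) (a : Cl ob Δ [] T),
      ∃ (s' : S) (m' : Nm Δ s') (A : Tm ob Δ [] (ob s')), Pr.outAs h m a = Pr.out m' A.cl := by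
    intro s T h m a
    subst h
    obtain ⟨A, rfl⟩ := a.exists_rep'
    exact ⟨s, m, A, rfl⟩
  cases p with
  | out m a =>
    obtain ⟨A, rfl⟩ := a.exists_rep'
    exact ⟨_, m, A.sub (NSub.id Δ) (trigSub hsel N Δ Γ), rfl⟩
  | inp m a => exact absurd trivial hp
  | var X => exact houtAs _ _ _
  | papp X a => exact houtAs _ _ _
  | napp X d => exact houtAs _ _ _

/-- Outputs at the same name of HO bisimilar closed terms. -/
def OutRel (p q : Pr ob Δ []) : Prop :=
  ∃ (s : S) (m : Nm Δ s) (A B : Tm ob Δ [] (ob s)),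
    p = .out m A.cl ∧ q = .out m B.cl ∧ HOBisimilarClosed A B

theorem OutRel.name_eq {s s' : S} {m : Nm Δ s} {m' : Nm Δ s'} {a : Cl ob Δ [] (ob s)}
    {b : Cl ob Δ [] (ob s')} (h : OutRel (.out m a) (.out m' b)) :
    (⟨s, m⟩ : Σ s, Nm Δ s) = ⟨s', m'⟩ := by
  obtain ⟨_, _, A, B, h1, h2, -⟩ := h
  cases h1
  cases h2
  rfl

theorem OutRel.bisimilar {s : S} {T : Ty S} {hT : ob s = T} {m m' : Nm Δ s} {A B : Tm ob Δ [] T}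
    (h : OutRel (.outAs hT m A.cl) (.outAs hT m' B.cl)) : HOBisimilarClosed A B := by
  subst hT
  obtain ⟨_, _, A', B', h1, h2, h3⟩ := h
  injection h1 with h4 h5 h6
  subst h4
  injection h2 with _ h7 h8
  exact h3.struct (Tm.cl_eq.1 (eq_of_heq h6).symm) (Tm.cl_eq.1 h8.symm)

/-- The constant that is the subject of an output. -/
def Pr.chan : Pr ob Δ Γ → Option ℕ
  | .out (.const n) _ => some n
  | _ => none

/-- The variable at the head of a component. -/
def Pr.head : Pr ob Δ Γ → Option (Σ T, Var Γ T)
  | .out _ _ => none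
  | .inp _ _ => none
  | .var X => some ⟨_, X⟩
  | .papp X _ => some ⟨_, X⟩
  | .napp X _ => some ⟨_, X⟩

theorem OutRel.chan_eq {p q : Pr ob Δ []} (h : OutRel p q) : p.chan = q.chan := by
  obtain ⟨_, m, A, B, rfl, rfl, -⟩ := h
  cases m <;> rfl

theorem Pr.chan_outAs {s : S} {T : Ty S} (h : ob s = T) (n : ℕ) (a : Cl ob Δ Γ T) :
    (Pr.outAs h (.const n) a).chan = some n := by
  subst h
  rfl

theorem Pr.chan_trig (N : ℕ) (p : Pr ob Δ Γ) :
    (p.trig hsel N).chan = (p.head.elim p.chan fun X => some (N + X.2.level)) := by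
  cases p with
  | out m a => cases m <;> rfl
  | inp m a => rfl
  | _ => exact Pr.chan_outAs _ _ _

/-! ### Fresh triggers through infinitely many starting indices -/

open Filter

/-- A constant already present equals a given trigger constant for at most one `N`, so it cannot
imitate it infinitely often; two trigger constants agree only if the levels, hence the variables,
agree. -/
theorem Pr.head_eq_of_frequently {p q : Pr ob Δ Γ}
    (h : ∃ᶠ N in atTop, OutRel (p.trig hsel N) (q.trig hsel N)) : p.head = q.head := by
  have h' : ∃ᶠ N in atTop, (p.trig hsel N).chan = (q.trig hsel N).chan :=
    h.mono fun N hN => hN.chan_eq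
  simp only [Pr.chan_trig] at h'
  have hne : ∀ (c : Option ℕ) (k : ℕ), ∀ᶠ N in atTop, c ≠ some (N + k) := by
    rintro (_ | c) k
    · exact Eventually.of_forall fun N => by simp
    · filter_upwards [eventually_gt_atTop c] with N hN
      simp only [ne_eq, Option.some.injEq]
      omega
  rcases hp : p.head with _ | X <;> rcases hq : q.head with _ | Y <;> rw [hp, hq] at h'
  · obtain ⟨N, h1, h2⟩ := (h'.and_eventually (hne p.chan Y.2.level)).exists
    exact absurd h1 h2
  · obtain ⟨N, h1, h2⟩ := (h'.and_eventually (hne q.chan X.2.level)).exists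
    exact absurd h1.symm h2
  · obtain ⟨N, hN⟩ := h'.exists
    simp only [Option.elim_some, Option.some.injEq, Nat.add_left_cancel_iff] at hN
    exact congrArg some (Var.level_inj X.2 Y.2 hN)

/-- The terms that are HO bisimilar for infinitely many substitutions of triggers. -/
def TrigRel : TRel ob := fun Δ Γ _ P Q => ∃ᶠ N in atTop,
  HOBisimilarClosed (P.sub (NSub.id Δ) (trigSub hsel N Δ Γ))
    (Q.sub (NSub.id Δ) (trigSub hsel N Δ Γ))

/-- Equal heads leave only the data to compare: emitted terms and arguments are compared along the
same infinite set of indices, while for the subject of an output or the name argument, which do not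
depend on `N`, one index suffices. -/
theorem TrigRel.prRel {p q : Pr ob Δ Γ} (hp : ¬ p.IsInp)
    (h : ∃ᶠ N in atTop, OutRel (p.trig hsel N) (q.trig hsel N)) :
    PrRel (TrigRel hsel) p q := by
  have hhead := Pr.head_eq_of_frequently hsel h
  cases p with
  | out m a =>
    cases q with
    | out m' b =>
      obtain ⟨A, rfl⟩ := a.exists_rep'
      obtain ⟨B, rfl⟩ := b.exists_rep'
      obtain ⟨N, hN⟩ := h.exists
      cases OutRel.name_eq hN
      exact .out m A B rfl rfl (h.mono fun N hN => OutRel.bisimilar (hT := rfl) hN)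
    | inp m' b =>
      obtain ⟨N, _, _, _, _, _, hN, _⟩ := h.exists
      cases hN
    | _ => cases hhead
  | inp m a => exact absurd trivial hp
  | var X =>
    cases q <;> cases hhead
    exact .var X
  | papp X a =>
    cases q <;> cases hhead
    rename_i b
    obtain ⟨A, rfl⟩ := a.exists_rep'
    obtain ⟨B, rfl⟩ := b.exists_rep'
    exact .papp X A B rfl rfl (h.mono fun N hN => OutRel.bisimilar hN)
  | napp X d =>
    cases q <;> cases hhead
    obtain ⟨N, hN⟩ := h.exists
    cases (OutRel.bisimilar hN).inp_nil_inj
    exact .napp X d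

/-- Pigeonhole over the finitely many possible answers. It gives infinitely many `N`, not almost
all, which is why `TrigRel` is defined by frequency. -/
theorem exists_frequently_of_mem {α : Type u} {s : Multiset α} {p : α → ℕ → Prop}
    (h : ∃ᶠ N in atTop, ∃ q ∈ s, p q N) : ∃ q ∈ s, ∃ᶠ N in atTop, p q N := by
  induction s using Multiset.induction with
  | empty =>
    obtain ⟨N, q, hq, -⟩ := h.exists
    simp at hq
  | cons a s ih =>
    simp only [Multiset.mem_cons, exists_eq_or_imp, frequently_or_distrib] at h ⊢
    exact h.imp id ih

theorem TrigRel.sim {P Q : Tm ob Δ Γ Ty.proc} (h : TrigRel hsel P Q) :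
    Sim (TrigRel hsel) P Q where
  comp p P' hp hP' := by
    -- The remainder is quantified universally, being determined by `q` up to congruence; so the
    -- pigeonhole has only `q` to fix.
    have h1 : ∃ᶠ N in atTop, ∃ q ∈ Q.comps, OutRel (p.trig hsel N) (q.trig hsel N) ∧
        ∀ Q' : Tm ob Δ Γ Ty.proc, Q.comps = q ::ₘ Q'.comps →
          HOBisimilarClosed (P'.sub (NSub.id Δ) (trigSub hsel N Δ Γ))
            (Q'.sub (NSub.id Δ) (trigSub hsel N Δ Γ)) := by
      refine h.mono fun N hN => ?_
      obtain ⟨s, m, A, hA⟩ := Pr.exists_trig_eq_out hsel N hp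
      have hout : OutStep m A _ _ := OutStep.iff_comps.2
        (Tm.comps_sub_cons hP' ((Pr.sub_trigSub hsel N p).trans (congrArg _ hA)))
      obtain ⟨B, Q'', h2, h3, h4⟩ := hN.out hout
      obtain ⟨q, Q', h5, h6, h7⟩ := Tm.comps_sub_eq_cons
        (fun q _ => ⟨_, Pr.sub_trigSub hsel N q⟩) (OutStep.iff_comps.1 h2)
      rw [Pr.sub_trigSub, Multiset.singleton_inj] at h6
      refine ⟨q, by rw [h5]; exact Multiset.mem_cons_self _ _, ⟨s, m, A, B, hA, h6, h3⟩,
        fun Q₁ hQ₁ => h4.struct (SC.refl _) (h7.trans (SC.sub (Tm.comps_eq_iff.1 ?_) _ _))⟩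
      rw [h5, Multiset.cons_inj_right] at hQ₁
      exact hQ₁
    obtain ⟨q, hq, h2⟩ := exists_frequently_of_mem h1
    obtain ⟨Q', hQ'⟩ := Tm.exists_comps_eq_cons hq
    exact ⟨q, Q', hQ', TrigRel.prRel hsel hp (h2.mono fun N hN => hN.1),
      h2.mono fun N hN => hN.2 Q' hQ'⟩
  inp {s} m P' hP' := by
    -- The continuation and the remainder are again determined by `q` up to congruence, so only `q`
    -- has to be chosen independently of `N`.
    have h1 : ∃ᶠ N in atTop, ∃ q ∈ Q.comps, (∃ Q₁ : Tm ob Δ (ob s :: Γ) Ty.proc,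
          q = Pr.inp m Q₁.cl) ∧
        ∀ (Q₁ : Tm ob Δ (ob s :: Γ) Ty.proc) (R : Tm ob Δ Γ Ty.proc), q = Pr.inp m Q₁.cl →
          Q.comps = q ::ₘ R.comps →
          HOBisimilarClosed (P'.sub (NSub.id Δ) (trigSub hsel N Δ (ob s :: Γ)))
            ((Tm.par Q₁ (R.wk (ob s))).sub (NSub.id Δ) (trigSub hsel N Δ (ob s :: Γ))) := by
      refine h.mono fun N hN => ?_
      have hin := hP'.sub (NSub.id Δ) (trigSub hsel N Δ Γ)
      rw [Nm.nsub_id] at hin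
      obtain ⟨Q'', h2, h3⟩ := hN.inp hin
      obtain ⟨m₀, Q', h4, h5, h6⟩ := h2.of_sub fun q _ hq =>
        ⟨_, Pr.sub_trigSub hsel N q, by
          obtain ⟨_, _, _, h⟩ := Pr.exists_trig_eq_out hsel N hq
          rw [h]
          exact id⟩
      rw [Nm.nsub_id] at h4
      subst h4
      obtain ⟨Q₁, R, h7, h8⟩ := InStep.iff_comps.1 h5
      refine ⟨_, by rw [h7]; exact Multiset.mem_cons_self _ _, ⟨Q₁, rfl⟩,
        fun Q₂ R₂ hQ₂ hR₂ => ?_⟩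
      -- Of all closed arguments only the next trigger is used: it turns the lifted substitution
      -- into the trigger substitution of the larger scope.
      have h9 := (h3 (trigger hsel (N + Γ.length) (ob s))).struct (SC.refl _) (h6.inst _)
      rw [Tm.inst_sub_lift, Tm.inst_sub_lift, trigSub_cons] at h9
      refine h9.struct (SC.refl _) (SC.sub (h8.trans (SC.par ?_ (SC.wk ?_))) _ _)
      · injection hQ₂ with _ _ h10
        exact Tm.cl_eq.1 h10
      · rw [h7, Multiset.cons_inj_right] at hR₂
        exact Tm.comps_eq_iff.1 hR₂
    obtain ⟨q, hq, h2⟩ := exists_frequently_of_mem h1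
    obtain ⟨N, ⟨Q₁, rfl⟩, -⟩ := h2.exists
    obtain ⟨R, hR⟩ := Tm.exists_comps_eq_cons hq
    exact ⟨_, InStep.iff_comps.2 ⟨Q₁, R, hR, SC.refl _⟩, h2.mono fun N hN => hN.2 Q₁ R rfl hR⟩

theorem TrigRel.bis {T : Ty S} {P Q : Tm ob Δ Γ T} (h : TrigRel hsel P Q) :
    Bis (TrigRel hsel) P Q := by
  cases T with
  | proc => exact ⟨h.sim, TrigRel.sim hsel (h.mono fun N hN => hN.symm)⟩
  | pabs T =>
    refine h.mono fun N hN => ?_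
    have := (hN.pbody (trigger hsel (N + Γ.length) T)).struct
      ((SC.sub_pbody _ _ _).inst _) ((SC.sub_pbody _ _ _).inst _)
    rwa [Tm.inst_sub_lift, Tm.inst_sub_lift, trigSub_cons] at this
  | nabs s =>
    refine h.mono fun N hN => ?_
    have := hN.nbody.struct (SC.sub_nbody _ _ _) (SC.sub_nbody _ _ _)
    rwa [NSub.lift_id, trigSub_nlift] at this

theorem TrigRel.hoioBisimilar {T : Ty S} {P Q : Tm ob Δ Γ T} (h : TrigRel hsel P Q) :
    HOIOBisimilar P Q :=
  .coind (R := TrigRel hsel) (fun _ _ _ _ _ h => h.mono fun _ hN => hN.symm)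
    (fun _ _ _ _ _ h => (TrigRel.bis hsel h).mono fun _ _ _ _ _ h => .of_rel h) h

end triggers

/-- Surjectivity of `ob` supplies, for each type, a sort whose names carry it; the hypothesis then
gives bisimilarity of the trigger instances for every `N`. -/
theorem HOBisimilar.hoioBisimilar (hob : Function.Surjective ob) {Δ : List S}
    {Γ : List (Ty S)} {T : Ty S} {P Q : Tm ob Δ Γ T} (h : HOBisimilar P Q) :
    HOIOBisimilar P Q := by
  refine TrigRel.hoioBisimilar (Function.rightInverse_surjInv hob)
    (Filter.Frequently.of_forall fun N => ?_)
  simp only [← Tm.psub_eq_sub]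
  exact h _

/-- The only substitution out of the empty scope is the identity. -/
theorem HOBisimilarClosed.hoBisimilar {Δ : List S} {T : Ty S} {P Q : Tm ob Δ [] T}
    (h : HOBisimilarClosed P Q) : HOBisimilar P Q := by
  intro σ
  obtain rfl : σ = PSub.id ob Δ [] := PSub.ext fun _ X => by cases X
  rwa [Tm.psub_id, Tm.psub_id]

end HOmp

theorem mainTheorem3 {S : Type*} (ob : S → HOmp.Ty S) (hob : Function.Surjective ob) :
    (∀ {Δ : List S} {T : HOmp.Ty S} (P Q : HOmp.Tm ob Δ [] T),
      HOmp.HOBisimilarClosed P Q ↔ HOmp.HOIOBisimilar P Q) ∧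
    (∀ {Δ : List S} {Γ : List (HOmp.Ty S)} {T : HOmp.Ty S} (P Q : HOmp.Tm ob Δ Γ T),
      HOmp.HOBisimilar P Q ↔ HOmp.HOIOBisimilar P Q) :=
  ⟨fun _ _ => ⟨fun h => h.hoBisimilar.hoioBisimilar hob, fun h => h.hoBisimilarClosed⟩,
    fun _ _ => ⟨fun h => h.hoioBisimilar hob, fun h => h.hoBisimilar⟩⟩
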